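/- Setting. For a cutoff $\Lambda\ge 1$ let $\mathcal H_\Lambda=\mathrm{span}\{|0\rangle,\dots,|\Lambda\rangle\}$, let $a$ be the truncated annihilation operator ($a|n\rangle=\sqrt n\,|n-1\rangle$) and $a^\dagger$ its adjoint. On $\mathcal H_2\otimes\mathcal H_\Lambda$ (written in $2\times2$ blocks) put $$\mathcal T_k(t)=\exp\left(it\begin{bmatrix}0&(a^\dagger)^k\\a^k&0\end{bmatrix}\right),\qquad \mathcal S_1(t)=\mathcal T_1(t).$$ Circuits are finite sequences of gates $\mathcal S_1(t)$ ($t\in\mathbb R$, $\mathcal S_1(t)^{-1}=\mathcal S_1(-t)$) and of the qubit gates $X$, $H$, $S$, $S^\dagger$; only the $\mathcal S_1$ gates are counted. Product formulas. For circuit families $U(t),V(t)$, with $U(-t)=U(t)^{-1}$ and $V(-t)=V(t)^{-1}$ as operators, let $\mathrm{BCH}_1(U,V)(t)=U(t)V(t)U(-t)V(-t)$ and, writing $W_q=\mathrm{BCH}_q(U,V)$, $$W_{q+1}(t)=W_q(\gamma_qt)W_q(-\gamma_qt)\,W_q(\beta_qt)^{-1}W_q(-\beta_qt)^{-1}\,W_q(\gamma_qt)W_q(-\gamma_qt),$$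 where $\beta_q=\sqrt{2r_q}$, $\gamma_q=\sqrt{1/4+r_q}$, $r_q=\frac{2^{1/(q+1)}}{4(2-2^{1/(q+1)})}$. Let $\mathrm{Tr}_1(U,V)(t)=U(t/2)V(t/2)V(t/2)U(t/2)$ and, writing $R_s=\mathrm{Tr}_s(U,V)$ and $c_s=(4-4^{1/(2s-1)})^{-1}$, $$R_s(t)=R_{s-1}(c_st)^2\,R_{s-1}((1-4c_s)t)\,R_{s-1}(c_st)^2\qquad(s\ge2).$$ Algorithms. For a circuit family $U$ and orders $q,s\ge1$ let $\mathrm{ADD}_{q,s}(U)(t)=X\,\mathrm{Tr}_s(L,R)(t)\,X$, where for $t\ge0$, with $\tau=\sqrt{t/2}$, $$L(t)=SH\cdot\mathrm{BCH}_q(XUX,\,U)(\tau)\cdot HS^\dagger,\qquad R(t)=H\cdot\mathrm{BCH}_q(SUS^\dagger,\,XUX)(\tau)\cdot H,$$ and $L(-t)=L(t)^{-1}$, $R(-t)=R(t)^{-1}$. For real $p\ge1$ put $q(p)=\max(\lceil (2p-1)/2\rceil,1)$. For $\ell\ge2$ and $k=2^\ell$ define recursively $$\mathrm{POWER}(k,\cdot,p)=\mathrm{ADD}_{q(p),q(p)}\big(\mathrm{POWER}(k/2,\cdot,2p)\big),$$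 starting from the second-order step $\mathrm{POWER}(2,\cdot,p)=\mathrm{ADD}_{q(p),\lceil p/2\rceil}(\mathcal S_1)$. Let $\mathrm{POWER}'$ be the variant in which the step $k=2$ also follows the general rule, $\mathrm{POWER}'(2,\cdot,p)=\mathrm{ADD}_{q(p),q(p)}(\mathcal S_1)$. Theorem. Let $k=2^\ell$ with $\ell\ge1$ and let $p\ge1$ be real. There is a constant $C>0$, depending only on $k$ and $p$, such that for every $\Lambda\ge1$ and every $t\ge0$ the operators $\mathrm{POWER}(k,t,p)$ and $\mathrm{POWER}'(k,t,p)$ are unitary and, in operator norm, $$\big\|\mathrm{POWER}(k,t,p)-\mathcal T_k(t)\big\|\le C\,(\Lambda^{k/2}t)^p,\qquad \big\|\mathrm{POWER}'(k,t,p)-\mathcal T_k(t)\big\|\le C\,(\Lambda^{k/2}t)^p.$$ Moreover, for every $t\ge0$, the circuit $\mathrm{POWER}(k,t,p)$ uses at most $6^{\log_2k}\cdot420^{kp/2}$ gates $\mathcal S_1$, and $\mathrm{POWER}'(k,t,p)$ uses at most $6^{\log_2k}\cdot30^{(k-1)p}$. -/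

import Mathlib

open scoped Matrix Matrix.Norms.L2Operator

namespace QubitBoson

noncomputable section

/-! ### The qubit-qumode space and the generators

The truncated mode `H_Λ` is spanned by the Fock states with at most `Λ` photons, so it has
dimension `Λ + 1`. Operators on `H_2 ⊗ H_Λ` are written as `2 × 2` block matrices. -/

/-- Index set of the computational basis of `H_2 ⊗ H_Λ`: `Sum.inl n` stands for `|0⟩|n⟩` and
`Sum.inr n` for `|1⟩|n⟩`. -/
abbrev Idx (Λ : ℕ) : Type := Fin (Λ + 1) ⊕ Fin (Λ + 1)

/-- Operators on `H_2 ⊗ H_Λ`. The norm on them is the operator norm for the Euclidean norm. -/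
abbrev Op (Λ : ℕ) : Type := Matrix (Idx Λ) (Idx Λ) ℂ

/-- The truncated annihilation operator: `a |n⟩ = √n |n - 1⟩`. -/
def annihilation (Λ : ℕ) : Matrix (Fin (Λ + 1)) (Fin (Λ + 1)) ℂ :=
  Matrix.of fun i j => if (i : ℕ) + 1 = (j : ℕ) then ((Real.sqrt (j : ℕ) : ℝ) : ℂ) else 0

/-- The truncated creation operator `a†`. -/
def creation (Λ : ℕ) : Matrix (Fin (Λ + 1)) (Fin (Λ + 1)) ℂ := (annihilation Λ)ᴴ

/-- The block matrix `[[0, (a†)^k], [a^k, 0]]`. -/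
def blockHam (Λ k : ℕ) : Op Λ :=
  Matrix.fromBlocks 0 (creation Λ ^ k) (annihilation Λ ^ k) 0

/-- `T_k(t) = exp (i t [[0, (a†)^k], [a^k, 0]])`. -/
def target (Λ k : ℕ) (t : ℝ) : Op Λ :=
  NormedSpace.exp ((Complex.I * (t : ℂ)) • blockHam Λ k)

/-- The qubit operator `[[α, β], [γ, δ]]`, acting as `[[α, β], [γ, δ]] ⊗ 1`. -/
def qubitOp (Λ : ℕ) (α β γ δ : ℂ) : Op Λ :=
  Matrix.fromBlocks (α • 1) (β • 1) (γ • 1) (δ • 1)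

/-! ### Circuits -/

/-- The elementary gates: `S_1(t) = exp (i t [[0, a†], [a, 0]])`, and the qubit gates
`X`, `H` (Hadamard), `S` (phase gate) and `S†`. -/
inductive Gate : Type
  | s1 (t : ℝ) : Gate
  | x : Gate
  | h : Gate
  | s : Gate
  | sdg : Gate

namespace Gate

/-- The unitary implemented by a gate. -/
def mat (Λ : ℕ) : Gate → Op Λ
  | s1 t => target Λ 1 t
  | x => qubitOp Λ 0 1 1 0
  | h => qubitOp Λ (((Real.sqrt 2)⁻¹ : ℝ) : ℂ) (((Real.sqrt 2)⁻¹ : ℝ) : ℂ)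
      (((Real.sqrt 2)⁻¹ : ℝ) : ℂ) (-(((Real.sqrt 2)⁻¹ : ℝ) : ℂ))
  | s => qubitOp Λ 1 0 0 Complex.I
  | sdg => qubitOp Λ 1 0 0 (-Complex.I)

/-- The inverse gate; `S_1(t)⁻¹ = S_1(-t)`. -/
def inv : Gate → Gate
  | s1 t => s1 (-t)
  | x => x
  | h => h
  | s => sdg
  | sdg => s

/-- Whether the gate is an `S_1` gate. -/
def isS1 : Gate → Bool
  | s1 _ => true
  | _ => false

end Gate

/-- A circuit is a sequence of gates, listed in the order of the operator product. -/
abbrev Circuit : Type := List Gate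

namespace Circuit

/-- The operator implemented by a circuit: the product `g₁ g₂ ⋯ gₙ`. -/
def eval (Λ : ℕ) (c : Circuit) : Op Λ := (c.map (Gate.mat Λ)).prod

/-- The inverse circuit. -/
def inv (c : Circuit) : Circuit := (c.map Gate.inv).reverse

/-- The number of `S_1` gates in a circuit. -/
def s1Count (c : Circuit) : ℕ := c.countP Gate.isS1

end Circuit

/-! ### Product formulas on circuit families

A family `U : ℝ → Circuit` approximates `t ↦ exp (t A)`. Throughout, `U (-t)` implements the
inverse of `U t`, as `exp (-t A)` is the inverse of `exp (t A)`. -/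

/-- The constant `r_p` of the BCH formula `BCH_{p,1}`. -/
def bchR (p : ℕ) : ℝ :=
  (2 : ℝ) ^ ((2 : ℝ) / (2 * p + 2)) / (4 * (2 - (2 : ℝ) ^ ((2 : ℝ) / (2 * p + 2))))

/-- The constant `β_p = (2 r_p)^{1/2}`. -/
def bchBeta (p : ℕ) : ℝ := Real.sqrt (2 * bchR p)

/-- The constant `γ_p = (1/4 + r_p)^{1/2}`. -/
def bchGamma (p : ℕ) : ℝ := Real.sqrt (1 / 4 + bchR p)

/-- The BCH product formula `BCH_{p,1}` of order `p ≥ 1`, approximating `exp (t² [A, B])` for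
families `U ≈ exp (t A)` and `V ≈ exp (t B)`. The order `0` is not used. -/
def bch : ℕ → (ℝ → Circuit) → (ℝ → Circuit) → ℝ → Circuit
  | 0, _, _, _ => []
  | 1, U, V, t => U t ++ V t ++ U (-t) ++ V (-t)
  | p + 2, U, V, t =>
      bch (p + 1) U V (bchGamma (p + 1) * t) ++ bch (p + 1) U V (-(bchGamma (p + 1) * t)) ++
      (bch (p + 1) U V (bchBeta (p + 1) * t)).inv ++
      (bch (p + 1) U V (-(bchBeta (p + 1) * t))).inv ++
      bch (p + 1) U V (bchGamma (p + 1) * t) ++ bch (p + 1) U V (-(bchGamma (p + 1) * t))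

/-- Suzuki's constant `p_k = (4 - 4^{1/(2k-1)})⁻¹`. -/
def suzuki (k : ℕ) : ℝ := (4 - (4 : ℝ) ^ ((1 : ℝ) / (2 * (k : ℝ) - 1)))⁻¹

/-- The Trotter-Suzuki formula `Trotter_{2k}` of order `k ≥ 1` for two terms, approximating
`exp (t (A + B))` for families `U ≈ exp (t A)` and `V ≈ exp (t B)`. The order `0` is not used. -/
def trotter : ℕ → (ℝ → Circuit) → (ℝ → Circuit) → ℝ → Circuit
  | 0, _, _, _ => []
  | 1, U, V, t => U (t / 2) ++ V (t / 2) ++ V (t / 2) ++ U (t / 2)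
  | k + 2, U, V, t =>
      trotter (k + 1) U V (suzuki (k + 2) * t) ++ trotter (k + 1) U V (suzuki (k + 2) * t) ++
      trotter (k + 1) U V ((1 - 4 * suzuki (k + 2)) * t) ++
      trotter (k + 1) U V (suzuki (k + 2) * t) ++ trotter (k + 1) U V (suzuki (k + 2) * t)

/-- Extends a family given for `t ≥ 0` to negative times by inversion. -/
def oddExtend (U : ℝ → Circuit) (t : ℝ) : Circuit :=
  if 0 ≤ t then U t else (U (-t)).inv

/-- Conjugation `X U X`. -/
def conjX (U : ℝ → Circuit) (t : ℝ) : Circuit := [Gate.x] ++ U t ++ [Gate.x]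

/-- Conjugation `S U S†`. -/
def conjS (U : ℝ → Circuit) (t : ℝ) : Circuit := [Gate.s] ++ U t ++ [Gate.sdg]

/-! ### The algorithms ADD and POWER -/

/-- `Left'(t) = S H · BCH_q(X B_B(τ) X, B_A(τ)) · H S†` with `τ = √(t/2)`. -/
def addLeft (q : ℕ) (UA UB : ℝ → Circuit) : ℝ → Circuit :=
  oddExtend fun t =>
    [Gate.s, Gate.h] ++ bch q (conjX UB) UA (Real.sqrt (t / 2)) ++ [Gate.h, Gate.sdg]

/-- `Right'(t) = H · BCH_q(S B_A(τ) S†, X B_B(τ) X) · H` with `τ = √(t/2)`. -/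
def addRight (q : ℕ) (UA UB : ℝ → Circuit) : ℝ → Circuit :=
  oddExtend fun t =>
    [Gate.h] ++ bch q (conjS UA) (conjX UB) (Real.sqrt (t / 2)) ++ [Gate.h]

/-- The body of ADD, with BCH order `q` and Trotter order `s`: from approximations of
`exp (i t [[0, A], [A†, 0]])` and `exp (i t [[0, B], [B†, 0]])` it builds one of
`exp (i t [[0, A B], [(A B)†, 0]])`, namely `X · Trotter_{2s}(Left', Right')(t) · X`. -/
def addWith (q s : ℕ) (UA UB : ℝ → Circuit) : ℝ → Circuit :=
  conjX (trotter s (addLeft q UA UB) (addRight q UA UB))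

/-- The order `max (⌈(p - 1) / 2⌉, 1)` of the product formulas used by ADD on inputs of
order `p`. -/
def adderOrder (p : ℝ) : ℕ := max ⌈(p - 1) / 2⌉₊ 1

/-- ADD on input families of orders `pA` and `pB`. -/
def add (pA pB : ℝ) (UA UB : ℝ → Circuit) : ℝ → Circuit :=
  addWith (adderOrder (min pA pB)) (adderOrder (min pA pB)) UA UB

/-- The single gate `S_1(t)` as a circuit family. -/
def s1Family (t : ℝ) : Circuit := [Gate.s1 t]

/-- The second-order block encoding of order `p`, built from the error-free `S_1`: it is ADD with
the Trotter order reduced to `⌈p/2⌉`. (For integer `p` its BCH order is `p`.) -/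
def secondOrder (p : ℝ) : ℝ → Circuit :=
  addWith (adderOrder (2 * p)) ⌈p / 2⌉₊ s1Family s1Family

/-- POWER(2^ℓ, t, p), where the step from `S_1` to `k = 2` is the second-order block encoding;
all other steps are ADD applied to two copies of POWER(2^(ℓ-1), ·, 2p). -/
def power : ℕ → ℝ → ℝ → Circuit
  | 0, _ => s1Family
  | 1, p => secondOrder p
  | ℓ + 2, p => add (2 * p) (2 * p) (power (ℓ + 1) (2 * p)) (power (ℓ + 1) (2 * p))

/-- POWER(2^ℓ, t, p), where every step, including the one from `S_1` to `k = 2`, is ADD. -/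
def powerAllAdd : ℕ → ℝ → ℝ → Circuit
  | 0, _ => s1Family
  | ℓ + 1, p => add (2 * p) (2 * p) (powerAllAdd ℓ (2 * p)) (powerAllAdd ℓ (2 * p))

end

end QubitBoson

namespace QubitBoson

noncomputable section

/-! ### Product formulas in a group -/

/-! If M_k is the block matrix with entries (a†)^k and a^k, then i/2 times the commutators of
suitable qubit conjugates of M_k are, after a further qubit conjugation, two matrices whose sum is X
M_{2k} X (`hamSA_two_mul`). A BCH formula run for time √(t/2) simulates each commutator, and a
Trotter-Suzuki formula adds them, so each ADD step doubles k. The square root halves the order: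
inputs of order 2p give an output of order p (`Approx.bch`, `Approx.trotter`, `Approx.addWith`).
Induction on ℓ starts from the exact gate, which has every order.

The error of a step splits in two. Replacing the exact exponentials by approximating circuits costs
a constant factor, because errors of unitaries add under products and are unchanged by inversion
(`norm_groupBch_sub_le`, `norm_groupTrotter_sub_le`). The error of the formula on exact exponentials
comes from expansions in a Banach algebra (`groupBch_expansion`, `groupTrotter_expansion`): leading
error coefficients add under multiplication, and the constants β, γ and c_s are chosen so that the
sums cancel.

Uniformity in Λ is obtained by expanding only once, in the ℓ^∞ product of the operator algebras over
all cutoffs and all pairs of self-adjoint contractions. The remainder there is bounded near t = 0,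
while away from 0 two unitaries differ by at most 2. Rescaling time by the norm bound ν = Λ^{k/2}
(`norm_hamSA_le`) reduces general generators to contractions and produces the power (Λ^{k/2} t)^p.

The gate counts are exact products 16·5^s·6^q per step, with q and s here one less than the orders;
the stated bounds follow by estimating the ceilings. -/

/-- The BCH product formula for two families in a group. -/
def groupBch {G : Type*} [Group G] : ℕ → (ℝ → G) → (ℝ → G) → ℝ → G
  | 0, _, _, _ => 1
  | 1, U, V, t => U t * V t * U (-t) * V (-t)
  | p + 2, U, V, t =>
      groupBch (p + 1) U V (bchGamma (p + 1) * t) * groupBch (p + 1) U V (-(bchGamma (p + 1) * t)) *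
      (groupBch (p + 1) U V (bchBeta (p + 1) * t))⁻¹ *
      (groupBch (p + 1) U V (-(bchBeta (p + 1) * t)))⁻¹ *
      groupBch (p + 1) U V (bchGamma (p + 1) * t) * groupBch (p + 1) U V (-(bchGamma (p + 1) * t))

/-- The Trotter-Suzuki product formula for two families in a group. -/
def groupTrotter {G : Type*} [Group G] : ℕ → (ℝ → G) → (ℝ → G) → ℝ → G
  | 0, _, _, _ => 1
  | 1, U, V, t => U (t / 2) * V (t / 2) * V (t / 2) * U (t / 2)
  | k + 2, U, V, t =>
      groupTrotter (k + 1) U V (suzuki (k + 2) * t) *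
      groupTrotter (k + 1) U V (suzuki (k + 2) * t) *
      groupTrotter (k + 1) U V ((1 - 4 * suzuki (k + 2)) * t) *
      groupTrotter (k + 1) U V (suzuki (k + 2) * t) *
      groupTrotter (k + 1) U V (suzuki (k + 2) * t)

section GroupFormulas

variable {G G' : Type*} [Group G] [Group G']

lemma map_groupBch (f : G →* G') (q : ℕ) (U V : ℝ → G) (t : ℝ) :
    f (groupBch q U V t) = groupBch q (fun s => f (U s)) (fun s => f (V s)) t := by
  induction q generalizing t with
  | zero => simp [groupBch]
  | succ q ih =>
    cases q with
    | zero => simp [groupBch]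
    | succ q => simp only [groupBch, map_mul, map_inv, ih]

lemma map_groupTrotter (f : G →* G') (q : ℕ) (U V : ℝ → G) (t : ℝ) :
    f (groupTrotter q U V t) = groupTrotter q (fun s => f (U s)) (fun s => f (V s)) t := by
  induction q generalizing t with
  | zero => simp [groupTrotter]
  | succ q ih =>
    cases q with
    | zero => simp [groupTrotter]
    | succ q => simp only [groupTrotter, map_mul, ih]

lemma groupBch_zero (q : ℕ) {U V : ℝ → G} (hU : U 0 = 1) (hV : V 0 = 1) :
    groupBch q U V 0 = 1 := by
  induction q with
  | zero => simp [groupBch]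
  | succ q ih =>
    cases q with
    | zero => simp [groupBch, hU, hV]
    | succ q => simp [groupBch, ih]

lemma groupTrotter_zero (q : ℕ) {U V : ℝ → G} (hU : U 0 = 1) (hV : V 0 = 1) :
    groupTrotter q U V 0 = 1 := by
  induction q with
  | zero => simp [groupTrotter]
  | succ q ih =>
    cases q with
    | zero => simp [groupTrotter, hU, hV]
    | succ q => simp [groupTrotter, ih]

lemma groupTrotter_neg (q : ℕ) {U V : ℝ → G} (hU : ∀ t, U (-t) = (U t)⁻¹)
    (hV : ∀ t, V (-t) = (V t)⁻¹) (t : ℝ) :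
    groupTrotter q U V (-t) = (groupTrotter q U V t)⁻¹ := by
  induction q generalizing t with
  | zero => simp [groupTrotter]
  | succ q ih =>
    cases q with
    | zero => simp [groupTrotter, neg_div, hU, hV, mul_assoc]
    | succ q => simp only [groupTrotter, mul_neg, ih, mul_inv_rev, mul_assoc]

end GroupFormulas

/-! ### The constants -/

/-- The second part is the defining equation of r in the form γ² x = β² with x = 2^{1/(q+2)}; its
power q + 2 is the cancellation condition in `bchGamma_pow_beta_pow`. -/
lemma bchR_pos (q : ℕ) : 0 < bchR (q + 1) ∧
    (1 / 4 + bchR (q + 1)) * (2 : ℝ) ^ ((2 : ℝ) / (2 * ((q + 1 : ℕ) : ℝ) + 2))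
      = 2 * bchR (q + 1) := by
  have h1 : (2 : ℝ) ^ ((2 : ℝ) / (2 * ((q + 1 : ℕ) : ℝ) + 2)) < 2 := by
    conv_rhs => rw [← Real.rpow_one 2]
    apply Real.rpow_lt_rpow_of_exponent_lt (by norm_num)
    rw [div_lt_one (by positivity)]
    push_cast
    have : (0 : ℝ) ≤ q := by positivity
    linarith
  have h0 : 0 < (2 : ℝ) ^ ((2 : ℝ) / (2 * ((q + 1 : ℕ) : ℝ) + 2)) := by positivity
  unfold bchR
  set x := (2 : ℝ) ^ ((2 : ℝ) / (2 * ((q + 1 : ℕ) : ℝ) + 2))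
  have h2 : 0 < 2 - x := by linarith
  constructor
  · positivity
  · field_simp
    ring

/-- Normalization: four forward factors at scale γ and two inverse factors at scale β leave the
coefficient of t²[A, B] equal to 1. -/
lemma bchGamma_sq_beta_sq (q : ℕ) : 4 * bchGamma (q + 1) ^ 2 - 2 * bchBeta (q + 1) ^ 2 = 1 := by
  have h := (bchR_pos q).1
  unfold bchGamma bchBeta
  rw [Real.sq_sqrt (by positivity), Real.sq_sqrt (by positivity)]
  ring

lemma bchGamma_pow_beta_pow (q : ℕ) :
    4 * bchGamma (q + 1) ^ (2 * q + 4) = 2 * bchBeta (q + 1) ^ (2 * q + 4) := by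
  obtain ⟨h, h2⟩ := bchR_pos q
  unfold bchGamma bchBeta
  rw [show 2 * q + 4 = 2 * (q + 2) by ring, pow_mul, pow_mul _ 2 (q + 2),
    Real.sq_sqrt (by positivity), Real.sq_sqrt (by positivity), ← h2, mul_pow,
    ← Real.rpow_mul_natCast (by norm_num)]
  have : (2 : ℝ) / (2 * ((q + 1 : ℕ) : ℝ) + 2) * ((q + 2 : ℕ) : ℝ) = 1 := by
    push_cast
    field_simp
    ring
  rw [this, Real.rpow_one]
  ring

/-- With x = 4^{1/(2s+3)} one has 1 - 4c = -xc, and the odd power 2s + 3 turns this into -4c^{2s+3}.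
-/
lemma suzuki_pow (s : ℕ) :
    4 * suzuki (s + 2) ^ (2 * s + 3) + (1 - 4 * suzuki (s + 2)) ^ (2 * s + 3) = 0 := by
  have h1 : (4 : ℝ) ^ ((1 : ℝ) / (2 * ((s + 2 : ℕ) : ℝ) - 1)) < 4 := by
    conv_rhs => rw [← Real.rpow_one 4]
    have : (0 : ℝ) ≤ s := by positivity
    apply Real.rpow_lt_rpow_of_exponent_lt (by norm_num)
    rw [div_lt_one] <;> push_cast <;> linarith
  have h2 : ((4 : ℝ) ^ ((1 : ℝ) / (2 * ((s + 2 : ℕ) : ℝ) - 1))) ^ (2 * s + 3) = 4 := by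
    rw [← Real.rpow_mul_natCast (by norm_num)]
    conv_rhs => rw [← Real.rpow_one 4]
    congr 1
    have : (0 : ℝ) ≤ s := by positivity
    push_cast
    rw [one_div, show 2 * ((s : ℝ) + 2) - 1 = 2 * s + 3 by ring, inv_mul_cancel₀ (by positivity)]
  unfold suzuki
  set x := (4 : ℝ) ^ ((1 : ℝ) / (2 * ((s + 2 : ℕ) : ℝ) - 1))
  have h3 : 1 - 4 * (4 - x)⁻¹ = - (x * (4 - x)⁻¹) := by
    have : 4 - x ≠ 0 := by linarith
    field_simp
    ring
  rw [h3, Odd.neg_pow ⟨s + 1, by ring⟩, mul_pow, h2]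
  ring

/-! ### Order expansions of analytic families in a Banach algebra -/

section Taylor

variable {E : Type*} [NormedAddCommGroup E] [NormedSpace ℝ E]

lemma exists_taylor_one {f : ℝ → E} (hf : AnalyticAt ℝ f 0) :
    ∃ g : ℝ → E, AnalyticAt ℝ g 0 ∧ g 0 = deriv f 0 ∧ ∀ t, f t = f 0 + t • g t := by
  refine ⟨dslope f 0, ?_, dslope_same _ _, fun t => ?_⟩
  · obtain ⟨p, hp⟩ := hf
    exact ⟨_, hp.has_fpower_series_dslope_fslope⟩
  · have := sub_smul_dslope f 0 t
    rw [sub_zero] at this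
    rw [this]
    abel

lemma exists_taylor_two {f : ℝ → E} (hf : AnalyticAt ℝ f 0) :
    ∃ (e : E) (g : ℝ → E), AnalyticAt ℝ g 0 ∧ ∀ t, f t = f 0 + t • e + t ^ 2 • g t := by
  obtain ⟨g, hg, -, hfg⟩ := exists_taylor_one hf
  obtain ⟨h, hh, -, hgh⟩ := exists_taylor_one hg
  refine ⟨g 0, h, hh, fun t => ?_⟩
  rw [hfg t, hgh t]
  module

end Taylor

variable {𝔸 : Type*} [NormedRing 𝔸] [NormedAlgebra ℝ 𝔸]

lemma exp_zero_smul (C : 𝔸) : NormedSpace.exp ((0 : ℝ) • C) = 1 := by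
  rw [zero_smul, NormedSpace.exp_zero]

lemma analyticAt_comp_mul {f : ℝ → 𝔸} (hf : AnalyticAt ℝ f 0) (c : ℝ) :
    AnalyticAt ℝ (fun t => f (c * t)) 0 := by
  apply AnalyticAt.fun_comp (f := fun t : ℝ => c * t) (by simpa using hf) (by fun_prop)

/-- `F` agrees with `exp (c t ^ j C) + t ^ m (a D + b t E)` up to an analytic multiple of
`t ^ (m + j)`. -/
def Expansion (j m : ℕ) (C D E : 𝔸) (c a b : ℝ) (F : ℝ → 𝔸) : Prop :=
  ∃ h : ℝ → 𝔸, AnalyticAt ℝ h 0 ∧ ∀ t : ℝ,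
    F t = NormedSpace.exp ((c * t ^ j) • C) + t ^ m • (a • D + (b * t) • E + t ^ j • h t)

/-- For BCH, where j = 2, two error coefficients D and E are exposed, since one recursion step
removes two orders at once. -/
lemma Expansion.of_eq {m : ℕ} {C : 𝔸} {c : ℝ} {F g : ℝ → 𝔸} (hg : AnalyticAt ℝ g 0)
    (h : ∀ t, F t = NormedSpace.exp ((c * t ^ 2) • C) + t ^ m • g t) :
    ∃ D E, Expansion 2 m C D E c 1 1 F := by
  obtain ⟨e, k, hk, h'⟩ := exists_taylor_two hg
  refine ⟨g 0, e, k, hk, fun t => ?_⟩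
  rw [h, h', one_mul, one_smul]

/-- For Trotter, where j = 1, only one coefficient is needed: the next order is removed by symmetry
instead. -/
lemma Expansion.of_eq' {m : ℕ} {C : 𝔸} {c : ℝ} {F g : ℝ → 𝔸} (hg : AnalyticAt ℝ g 0)
    (h : ∀ t, F t = NormedSpace.exp ((c * t) • C) + t ^ m • g t) :
    ∃ D, Expansion 1 m C D 0 c 1 0 F := by
  obtain ⟨k, hk, -, h'⟩ := exists_taylor_one hg
  refine ⟨g 0, k, hk, fun t => ?_⟩
  rw [h, h']
  simp

lemma Expansion.comp_mul {j m : ℕ} {C D E : 𝔸} {c a b : ℝ} {F : ℝ → 𝔸}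
    (hF : Expansion j m C D E c a b F) (k : ℝ) :
    Expansion j m C D E (c * k ^ j) (a * k ^ m) (b * k ^ (m + 1)) (fun t => F (k * t)) := by
  obtain ⟨h, hh, hF⟩ := hF
  refine ⟨fun t => k ^ (m + j) • h (k * t), (analyticAt_comp_mul hh k).fun_const_smul,
    fun t => ?_⟩
  simp only [hF, mul_pow, mul_assoc]
  congr 1
  module

variable [CompleteSpace 𝔸]

lemma exp_smul_mul_exp_smul (C : 𝔸) (a b : ℝ) :
    NormedSpace.exp (a • C) * NormedSpace.exp (b • C) = NormedSpace.exp ((a + b) • C) := by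
  let _ : NormedAlgebra ℚ 𝔸 := NormedAlgebra.restrictScalars ℚ ℝ 𝔸
  rw [add_smul, NormedSpace.exp_add_of_commute]
  exact ((Commute.refl C).smul_left a).smul_right b

lemma analyticAt_exp_comp (C : 𝔸) {f : ℝ → ℝ} (hf : AnalyticAt ℝ f 0) :
    AnalyticAt ℝ (fun t => NormedSpace.exp (f t • C)) 0 :=
  AnalyticAt.fun_comp (NormedSpace.exp_analytic (𝕂 := ℝ) _) (by fun_prop)

lemma exists_exp_taylor_one (C : 𝔸) :
    ∃ g : ℝ → 𝔸, AnalyticAt ℝ g 0 ∧ g 0 = C ∧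
      ∀ t : ℝ, NormedSpace.exp (t • C) = 1 + t • g t := by
  obtain ⟨g, hg, hg0, h⟩ :=
    exists_taylor_one (analyticAt_exp_comp C (f := fun t => t) (by fun_prop))
  refine ⟨g, hg, ?_, fun t => ?_⟩
  · rw [hg0]
    have := (hasDerivAt_exp_smul_const (𝕂 := ℝ) C (0 : ℝ)).deriv
    simpa using this
  · simpa using h t

lemma exists_exp_taylor_two (C : 𝔸) :
    ∃ g : ℝ → 𝔸, AnalyticAt ℝ g 0 ∧
      ∀ t : ℝ, NormedSpace.exp (t • C) = 1 + t • C + t ^ 2 • g t := by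
  obtain ⟨g, hg, hg0, h⟩ := exists_exp_taylor_one C
  obtain ⟨k, hk, -, h'⟩ := exists_taylor_one hg
  refine ⟨k, hk, fun t => ?_⟩
  rw [h, h', hg0]
  module

lemma exists_exp_pow (j : ℕ) (C : 𝔸) (c : ℝ) :
    ∃ g : ℝ → 𝔸, AnalyticAt ℝ g 0 ∧
      ∀ t : ℝ, NormedSpace.exp ((c * t ^ j) • C) = 1 + t ^ j • g t := by
  rcases Nat.eq_zero_or_pos j with rfl | hj
  · refine ⟨fun t => NormedSpace.exp ((c * t ^ 0) • C) - 1,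
      (analyticAt_exp_comp C (by fun_prop)).sub (by fun_prop), fun t => by simp⟩
  · obtain ⟨g, hg, -, h⟩ := exists_exp_taylor_one C
    refine ⟨fun t => c • g (c * t ^ j), ?_, fun t => ?_⟩
    · refine AnalyticAt.fun_const_smul
        (AnalyticAt.fun_comp (f := fun t : ℝ => c * t ^ j) ?_ (by fun_prop))
      simpa [hj.ne'] using hg
    · rw [h, smul_smul, mul_comm c]

namespace Expansion

variable {j m : ℕ} {C D E : 𝔸} {c a b c' a' b' : ℝ} {F F' : ℝ → 𝔸}

lemma exists_eq_one_add (hjm : j ≤ m) (hF : Expansion j m C D E c a b F) :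
    ∃ g : ℝ → 𝔸, AnalyticAt ℝ g 0 ∧ ∀ t : ℝ, F t = 1 + t ^ j • g t := by
  obtain ⟨d, rfl⟩ := Nat.exists_eq_add_of_le hjm
  obtain ⟨h, hh, hF⟩ := hF
  obtain ⟨g, hg, hexp⟩ := exists_exp_pow j C c
  refine ⟨fun t => g t + t ^ d • (a • D + (b * t) • E + t ^ j • h t), by fun_prop, fun t => ?_⟩
  rw [hF, hexp]
  module

/-- Both factors and both exponentials are 1 + O(t^j), so multiplying an error term by one of them
changes it only at order t^{m+j}. Hence the coefficients simply add, although D and E need not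
commute with C. -/
lemma mul (hjm : j ≤ m) (hF : Expansion j m C D E c a b F)
    (hF' : Expansion j m C D E c' a' b' F') :
    Expansion j m C D E (c + c') (a + a') (b + b') (fun t => F t * F' t) := by
  obtain ⟨p, hp, hFp⟩ := hF.exists_eq_one_add hjm
  obtain ⟨p', hp', hFp'⟩ := exists_exp_pow j C c'
  obtain ⟨h, hh, hF⟩ := hF
  obtain ⟨h', hh', hF'⟩ := hF'
  refine ⟨fun t => h t + h' t + (a • D + (b * t) • E + t ^ j • h t) * p' t
    + p t * (a' • D + (b' * t) • E + t ^ j • h' t), by fun_prop, fun t => ?_⟩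
  have e : F t * F' t = NormedSpace.exp ((c * t ^ j) • C) * NormedSpace.exp ((c' * t ^ j) • C)
      + t ^ m • ((a • D + (b * t) • E + t ^ j • h t) * NormedSpace.exp ((c' * t ^ j) • C)
        + F t * (a' • D + (b' * t) • E + t ^ j • h' t)) := by
    rw [hF' t, hF t]
    simp only [mul_add, add_mul, smul_add, smul_mul_assoc, mul_smul_comm]
    abel
  simp only [e]
  rw [exp_smul_mul_exp_smul, ← add_mul, hFp, hFp']
  simp only [mul_add, add_mul, smul_add, smul_mul_assoc, mul_smul_comm, mul_one, one_mul]
  module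

/-- If F = e + t^m X, then F' = e⁻¹ - t^m F' X e⁻¹. Both F' and e⁻¹ are 1 + O(t^j), so the leading
error is -t^m X. -/
lemma inv (hjm : j ≤ m) (hF : Expansion j m C D E c a b F) (hF' : AnalyticAt ℝ F' 0)
    (hinv : ∀ t, F' t * F t = 1) :
    Expansion j m C D E (-c) (-a) (-b) F' := by
  obtain ⟨p, hp, hFp⟩ := hF.exists_eq_one_add hjm
  obtain ⟨p', hp', hexp⟩ := exists_exp_pow j C (-c)
  obtain ⟨h, hh, hF⟩ := hF
  have h1 : ∀ t, F' t = 1 + t ^ j • (-(F' t * p t)) := fun t => by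
    have := hinv t
    rw [hFp, mul_add, mul_one, mul_smul_comm] at this
    rw [smul_neg, ← this]
    abel
  have h2 : ∀ t, F' t = NormedSpace.exp ((-c * t ^ j) • C)
      - t ^ m • (F' t * (a • D + (b * t) • E + t ^ j • h t)
        * NormedSpace.exp ((-c * t ^ j) • C)) := fun t => by
    have e1 : NormedSpace.exp ((c * t ^ j) • C) * NormedSpace.exp ((-c * t ^ j) • C) = 1 := by
      rw [exp_smul_mul_exp_smul, ← add_mul, add_neg_cancel, zero_mul, exp_zero_smul]
    have e2 : t ^ m • (a • D + (b * t) • E + t ^ j • h t)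
        = F t - NormedSpace.exp ((c * t ^ j) • C) := by
      rw [hF]; abel
    rw [← smul_mul_assoc, ← mul_smul_comm, e2, mul_sub, sub_mul, hinv, one_mul, mul_assoc, e1]
    simp
  refine ⟨fun t => -h t + (F' t * p t) * ((a • D + (b * t) • E + t ^ j • h t))
      - F' t * (a • D + (b * t) • E + t ^ j • h t) * p' t, by fun_prop, fun t => ?_⟩
  rw [h2 t]
  generalize hX : a • D + (b * t) • E + t ^ j • h t = X
  have h3 : F' t * X * NormedSpace.exp ((-c * t ^ j) • C)
      = X - t ^ j • (F' t * p t * X) + t ^ j • (F' t * X * p' t) := by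
    rw [hexp, mul_add, mul_one, mul_smul_comm]
    congr 1
    conv_lhs => rw [h1 t]
    rw [add_mul, one_mul, smul_mul_assoc, neg_mul, smul_neg, sub_eq_add_neg]
  rw [h3, sub_eq_add_neg, ← smul_neg, ← hX]
  congr 2
  module

end Expansion

/-! ### Order of the product formulas for exact exponentials -/

section Order

variable {𝔸 : Type*} [NormedRing 𝔸] [NormedAlgebra ℝ 𝔸]
variable {G : Type*} [Group G] {ρ : G →* 𝔸} {U V : ℝ → G} {a b : 𝔸}

lemma analyticAt_groupBch (hU : AnalyticAt ℝ (fun t => ρ (U t)) 0)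
    (hU' : AnalyticAt ℝ (fun t => ρ (U t)⁻¹) 0) (hV : AnalyticAt ℝ (fun t => ρ (V t)) 0)
    (hV' : AnalyticAt ℝ (fun t => ρ (V t)⁻¹) 0) (q : ℕ) :
    AnalyticAt ℝ (fun t => ρ (groupBch q U V t)) 0 ∧
      AnalyticAt ℝ (fun t => ρ (groupBch q U V t)⁻¹) 0 := by
  induction q with
  | zero =>
    simp only [groupBch, map_one, inv_one]
    exact ⟨by fun_prop, by fun_prop⟩
  | succ q ih =>
    cases q with
    | zero =>
      have h1 := analyticAt_comp_mul hU (-1)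
      have h2 := analyticAt_comp_mul hU' (-1)
      have h3 := analyticAt_comp_mul hV (-1)
      have h4 := analyticAt_comp_mul hV' (-1)
      simp only [neg_one_mul] at h1 h2 h3 h4
      simp only [groupBch, map_mul, mul_inv_rev]
      exact ⟨((hU.fun_mul hV).fun_mul h1).fun_mul h3,
        h4.fun_mul (h2.fun_mul (hV'.fun_mul hU'))⟩
    | succ q =>
      obtain ⟨h, h'⟩ := ih
      have h1 := analyticAt_comp_mul h (bchGamma (q + 1))
      have h2 := analyticAt_comp_mul h (-bchGamma (q + 1))
      have h3 := analyticAt_comp_mul h (bchBeta (q + 1))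
      have h4 := analyticAt_comp_mul h (-bchBeta (q + 1))
      have h5 := analyticAt_comp_mul h' (bchGamma (q + 1))
      have h6 := analyticAt_comp_mul h' (-bchGamma (q + 1))
      have h7 := analyticAt_comp_mul h' (bchBeta (q + 1))
      have h8 := analyticAt_comp_mul h' (-bchBeta (q + 1))
      simp only [neg_mul] at h2 h4 h6 h8
      simp only [groupBch, map_mul, mul_inv_rev, inv_inv]
      exact ⟨((((h1.fun_mul h2).fun_mul h7).fun_mul h8).fun_mul h1).fun_mul h2,
        h6.fun_mul (h5.fun_mul (h4.fun_mul (h3.fun_mul (h6.fun_mul h5))))⟩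

variable [CompleteSpace 𝔸]

lemma exp_smul_mul_exp_neg_smul (a : 𝔸) (t : ℝ) :
    NormedSpace.exp (t • a) * NormedSpace.exp (-t • a) = 1 := by
  rw [exp_smul_mul_exp_smul, add_neg_cancel, exp_zero_smul]

/-- It suffices to compare e^{ta}e^{tb} with e^{t²c}e^{tb}e^{ta}, where c = ab - ba, and then
multiply on the right by the inverses of the last two factors. Up to t² both sides agree, since
e^{ta}e^{tb} and e^{tb}e^{ta} differ there by t²c. -/
lemma exp_commutator_expansion (a b : 𝔸) :
    ∃ g : ℝ → 𝔸, AnalyticAt ℝ g 0 ∧ ∀ t : ℝ,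
      NormedSpace.exp (t • a) * NormedSpace.exp (t • b) * NormedSpace.exp (-t • a) *
        NormedSpace.exp (-t • b)
      = NormedSpace.exp (t ^ 2 • (a * b - b * a)) + t ^ 3 • g t := by
  obtain ⟨α, hα, hαa⟩ := exists_exp_taylor_two a
  obtain ⟨β, hβ, hβb⟩ := exists_exp_taylor_two b
  obtain ⟨κ, hκ, hκc⟩ := exists_exp_taylor_two (a * b - b * a)
  have hκ2 : AnalyticAt ℝ (fun t : ℝ => κ (t ^ 2)) 0 :=
    AnalyticAt.fun_comp (f := fun t : ℝ => t ^ 2) (by simpa using hκ) (by fun_prop)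
  have hA := analyticAt_exp_comp a (f := fun t => t) (by fun_prop)
  have hB := analyticAt_exp_comp b (f := fun t => t) (by fun_prop)
  have hA' := analyticAt_exp_comp a (f := fun t => -t) (by fun_prop)
  have hB' := analyticAt_exp_comp b (f := fun t => -t) (by fun_prop)
  -- The large factor is that difference divided by t³; the two trailing exponentials undo the
  -- multiplication by e^{tb}e^{ta}.
  refine ⟨fun t => (a * β t - β t * a + (α t * b - b * α t) + t • (α t * β t - β t * α t)
      - (a * b - b * a) * (a + b + t • (b * a + α t + β t) + t ^ 2 • (b * α t + β t * a)
          + t ^ 3 • (β t * α t))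
      - t • (κ (t ^ 2) * (NormedSpace.exp (t • b) * NormedSpace.exp (t • a))))
      * NormedSpace.exp (-t • a) * NormedSpace.exp (-t • b),
    ((AnalyticAt.fun_sub (by fun_prop) (AnalyticAt.fun_smul (by fun_prop)
      (hκ2.fun_mul (hB.fun_mul hA)))).fun_mul hA').fun_mul hB', fun t => ?_⟩
  generalize hc : a * b - b * a = c at *
  have h1 : NormedSpace.exp (t • b) * NormedSpace.exp (t • a) * NormedSpace.exp (-t • a) *
      NormedSpace.exp (-t • b) = 1 := by
    rw [mul_assoc (NormedSpace.exp (t • b)), exp_smul_mul_exp_neg_smul, mul_one,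
      exp_smul_mul_exp_neg_smul]
  have h2 : NormedSpace.exp (t • a) * NormedSpace.exp (t • b)
      - NormedSpace.exp (t ^ 2 • c) * (NormedSpace.exp (t • b) * NormedSpace.exp (t • a))
      = t ^ 3 • (a * β t - β t * a + (α t * b - b * α t) + t • (α t * β t - β t * α t)
      - c * (a + b + t • (b * a + α t + β t) + t ^ 2 • (b * α t + β t * a)
          + t ^ 3 • (β t * α t))
      - t • (κ (t ^ 2) * (NormedSpace.exp (t • b) * NormedSpace.exp (t • a)))) := by
    have e1 : NormedSpace.exp (t ^ 2 • c) * (NormedSpace.exp (t • b) * NormedSpace.exp (t • a))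
        = NormedSpace.exp (t • b) * NormedSpace.exp (t • a)
          + t ^ 2 • (c * (NormedSpace.exp (t • b) * NormedSpace.exp (t • a)))
          + t ^ 4 • (κ (t ^ 2) * (NormedSpace.exp (t • b) * NormedSpace.exp (t • a))) := by
      rw [hκc, add_mul, add_mul, one_mul, smul_mul_assoc, smul_mul_assoc, ← pow_mul]
    rw [e1]
    generalize hX : κ (t ^ 2) * (NormedSpace.exp (t • b) * NormedSpace.exp (t • a)) = X
    rw [hαa, hβb]
    simp only [mul_add, add_mul, smul_add, smul_mul_assoc, mul_smul_comm, mul_one, one_mul]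
    have hc' : c * (1 : 𝔸) = a * b - b * a := by rw [hc, mul_one]
    rw [← hc]
    module
  rw [← smul_mul_assoc, ← smul_mul_assoc, ← h2, sub_mul, sub_mul, mul_assoc (_ * _) _ _,
    mul_assoc (NormedSpace.exp (t ^ 2 • c)), mul_assoc (NormedSpace.exp (t ^ 2 • c)), h1, mul_one,
    add_sub_cancel]

theorem groupBch_expansion (hU : ∀ t, ρ (U t) = NormedSpace.exp (t • a))
    (hV : ∀ t, ρ (V t) = NormedSpace.exp (t • b)) (hU' : ∀ t, U (-t) = (U t)⁻¹)
    (hV' : ∀ t, V (-t) = (V t)⁻¹) (q : ℕ) :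
    ∃ g : ℝ → 𝔸, AnalyticAt ℝ g 0 ∧ ∀ t : ℝ,
      ρ (groupBch (q + 1) U V t)
        = NormedSpace.exp (t ^ 2 • (a * b - b * a)) + t ^ (2 * q + 3) • g t := by
  induction q with
  | zero =>
    obtain ⟨g, hg, h⟩ := exp_commutator_expansion a b
    refine ⟨g, hg, fun t => ?_⟩
    rw [groupBch, map_mul, map_mul, map_mul, hU, hU, hV, hV, h]
  | succ q ih =>
    obtain ⟨g, hg, hF⟩ := ih
    set C := a * b - b * a
    obtain ⟨D, E, hE⟩ := Expansion.of_eq (m := 2 * q + 3) (c := 1) (C := C)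
      (F := fun t => ρ (groupBch (q + 1) U V t)) hg (fun t => by rw [one_mul]; exact hF t)
    have han := analyticAt_groupBch (ρ := ρ) (U := U) (V := V)
      (by simpa only [hU] using analyticAt_exp_comp a (f := fun t => t) (by fun_prop))
      (by simpa only [← hU', hU] using analyticAt_exp_comp a (f := fun t => -t) (by fun_prop))
      (by simpa only [hV] using analyticAt_exp_comp b (f := fun t => t) (by fun_prop))
      (by simpa only [← hV', hV] using analyticAt_exp_comp b (f := fun t => -t) (by fun_prop))
      (q + 1)
    have hjm : 2 ≤ 2 * q + 3 := by omega
    have hI := hE.inv hjm han.2 (fun t => by rw [← map_mul, inv_mul_cancel, map_one])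
    -- Pairing t with -t cancels D, whose power 2q + 3 is odd. The coefficient of E has the even
    -- power 2q + 4 and is cancelled by balancing γ against β, so the error order rises by two.
    have hX := (hE.comp_mul (bchGamma (q + 1))).mul hjm (hE.comp_mul (-bchGamma (q + 1)))
    have hY := (hI.comp_mul (bchBeta (q + 1))).mul hjm (hI.comp_mul (-bchBeta (q + 1)))
    obtain ⟨h, hh, hW⟩ := (hX.mul hjm hY).mul hjm hX
    refine ⟨h, hh, fun t => ?_⟩
    have := hW t
    have e1 := bchGamma_sq_beta_sq q
    have e2 := bchGamma_pow_beta_pow q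
    have o : Odd (2 * q + 3) := ⟨q + 1, by ring⟩
    have ev : Even (2 * q + 3 + 1) := ⟨q + 2, by ring⟩
    simp only [o.neg_pow, ev.neg_pow, neg_sq] at this
    rw [show ∀ x y : ℝ, 1 * x ^ 2 + 1 * x ^ 2 + (-1 * y ^ 2 + -1 * y ^ 2)
        + (1 * x ^ 2 + 1 * x ^ 2) = 4 * x ^ 2 - 2 * y ^ 2 by intros; ring, e1,
      show ∀ x y : ℝ, 1 * x ^ (2 * q + 3 + 1) + 1 * x ^ (2 * q + 3 + 1)
        + (-1 * y ^ (2 * q + 3 + 1) + -1 * y ^ (2 * q + 3 + 1))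
        + (1 * x ^ (2 * q + 3 + 1) + 1 * x ^ (2 * q + 3 + 1))
        = 4 * x ^ (2 * q + 4) - 2 * y ^ (2 * q + 4) by intros; ring, e2, sub_self] at this
    simp only [groupBch, map_mul]
    simp only [neg_mul, mul_assoc] at this ⊢
    rw [this, one_mul]
    module

/-- A time-symmetric family has no leading error of even order: expanding F(t)F(-t) = 1, dividing by
t^m and letting t → 0 gives 2 g(0) = 0. -/
lemma eq_zero_of_symmetric {F g : ℝ → 𝔸} {C : 𝔸} {m : ℕ} (hm : Even m) (hm0 : 0 < m)
    (hg : AnalyticAt ℝ g 0)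
    (hF : ∀ t : ℝ, F t = NormedSpace.exp (t • C) + t ^ m • g t)
    (hs : ∀ t : ℝ, F t * F (-t) = 1) : g 0 = 0 := by
  let k : ℝ → 𝔸 := fun t => g t * NormedSpace.exp (-t • C) + NormedSpace.exp (t • C) * g (-t)
    + t ^ m • (g t * g (-t))
  have hg' : AnalyticAt ℝ (fun t => g (-t)) 0 := by
    simpa only [neg_one_mul] using analyticAt_comp_mul hg (-1)
  have hA := analyticAt_exp_comp C (f := fun t => t) (by fun_prop)
  have hA' := analyticAt_exp_comp C (f := fun t => -t) (by fun_prop)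
  have hk : ContinuousAt k 0 := AnalyticAt.continuousAt (𝕜 := ℝ)
    (((hg.fun_mul hA').fun_add (hA.fun_mul hg')).fun_add
      (AnalyticAt.fun_smul (by fun_prop) (hg.fun_mul hg')))
  have h0 : ∀ t : ℝ, t ≠ 0 → k t = 0 := fun t ht => by
    have h1 := hs t
    rw [hF, hF, hm.neg_pow] at h1
    have h2 : t ^ m • k t = 0 := by
      rw [mul_add, add_mul, exp_smul_mul_exp_neg_smul] at h1
      simp only [add_mul, smul_mul_assoc, mul_smul_comm] at h1
      have h3 := sub_eq_zero.mpr h1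
      rw [← h3]
      simp only [k]
      module
    exact (smul_eq_zero.mp h2).resolve_left (pow_ne_zero _ ht)
  have h1 : k 0 = 0 := by
    refine tendsto_nhds_unique (hk.tendsto.mono_left (nhdsWithin_le_nhds (s := {0}ᶜ))) ?_
    refine tendsto_const_nhds.congr' ?_
    filter_upwards [self_mem_nhdsWithin] with t ht
    exact (h0 t ht).symm
  have h2 : g 0 + g 0 = 0 := by
    simpa [k, hm0.ne'] using h1
  have h3 : (2 : ℝ) • g 0 = 0 := by rw [two_smul, h2]
  exact (smul_eq_zero.mp h3).resolve_left two_ne_zero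

lemma expansion_of_symmetric {F g : ℝ → 𝔸} {C : 𝔸} {m : ℕ} (hm : Even m) (hm0 : 0 < m)
    (hg : AnalyticAt ℝ g 0)
    (hF : ∀ t : ℝ, F t = NormedSpace.exp (t • C) + t ^ m • g t)
    (hs : ∀ t : ℝ, F t * F (-t) = 1) :
    ∃ h : ℝ → 𝔸, AnalyticAt ℝ h 0 ∧
      ∀ t : ℝ, F t = NormedSpace.exp (t • C) + t ^ (m + 1) • h t := by
  have h0 := eq_zero_of_symmetric hm hm0 hg hF hs
  obtain ⟨h, hh, -, hgh⟩ := exists_taylor_one hg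
  refine ⟨h, hh, fun t => ?_⟩
  rw [hF, hgh, h0, zero_add, smul_smul, pow_succ]

theorem groupTrotter_expansion (hU : ∀ t, ρ (U t) = NormedSpace.exp (t • a))
    (hV : ∀ t, ρ (V t) = NormedSpace.exp (t • b)) (hU' : ∀ t, U (-t) = (U t)⁻¹)
    (hV' : ∀ t, V (-t) = (V t)⁻¹) (s : ℕ) :
    ∃ g : ℝ → 𝔸, AnalyticAt ℝ g 0 ∧ ∀ t : ℝ,
      ρ (groupTrotter (s + 1) U V t)
        = NormedSpace.exp (t • (a + b)) + t ^ (2 * s + 3) • g t := by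
  have hsym : ∀ s t, ρ (groupTrotter (s + 1) U V t) * ρ (groupTrotter (s + 1) U V (-t)) = 1 :=
    fun s t => by rw [groupTrotter_neg _ hU' hV', ← map_mul, mul_inv_cancel, map_one]
  induction s with
  | zero =>
    obtain ⟨f, hf, hfa⟩ := exists_exp_taylor_two ((1 / 2 : ℝ) • a)
    obtain ⟨g, hg, hgb⟩ := exists_exp_taylor_two b
    obtain ⟨k, hk, hkc⟩ := exists_exp_taylor_two (a + b)
    -- Agreement through first order is enough here; symmetry promotes the error from t² to t³.
    refine expansion_of_symmetric (m := 2) (g := fun t => (2 : ℝ) • f t + g t - k t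
        + (((1 / 2 : ℝ) • a + t • f t) * (b + t • g t)
          + (b + t • g t) * ((1 / 2 : ℝ) • a + t • f t)
          + ((1 / 2 : ℝ) • a + t • f t) * ((1 / 2 : ℝ) • a + t • f t)
          + t • (((1 / 2 : ℝ) • a + t • f t) * (b + t • g t) * ((1 / 2 : ℝ) • a + t • f t))))
      even_two (by omega) (by fun_prop) (fun t => ?_) (hsym 0)
    have hB : ρ (V (t / 2)) * ρ (V (t / 2)) = NormedSpace.exp (t • b) := by
      rw [hV, exp_smul_mul_exp_smul, add_halves]
    have hA : ρ (U (t / 2)) = NormedSpace.exp (t • (1 / 2 : ℝ) • a) := by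
      rw [hU, smul_smul]
      congr 2
      ring
    rw [groupTrotter, map_mul, map_mul, map_mul, mul_assoc (ρ _) (ρ _) (ρ _), hB, hA, hfa, hgb, hkc]
    have e1 : ∀ x : 𝔸, 1 + t • ((1 / 2 : ℝ) • a) + t ^ 2 • x
        = 1 + t • ((1 / 2 : ℝ) • a + t • x) := fun x => by module
    have e2 : 1 + t • b + t ^ 2 • g t = 1 + t • (b + t • g t) := by module
    rw [e1, e2]
    generalize hX : (1 / 2 : ℝ) • a + t • f t = X
    generalize hY : b + t • g t = Y
    have e3 : (1 + t • X) * (1 + t • Y) * (1 + t • X) = 1 + t • ((2 : ℝ) • X + Y)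
        + t ^ 2 • (X * Y + Y * X + X * X + t • (X * Y * X)) := by
      simp only [mul_add, add_mul, smul_add, smul_mul_assoc, mul_smul_comm, mul_one, one_mul]
      module
    rw [e3]
    generalize X * Y + Y * X + X * X + t • (X * Y * X) = Z
    rw [← hX, ← hY]
    module
  | succ s ih =>
    obtain ⟨g, hg, hF⟩ := ih
    obtain ⟨D, hE⟩ := Expansion.of_eq' (m := 2 * s + 3) (c := 1) (C := a + b)
      (F := fun t => ρ (groupTrotter (s + 1) U V t)) hg (fun t => by rw [one_mul]; exact hF t)
    have hjm : 1 ≤ 2 * s + 3 := by omega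
    have hX := hE.comp_mul (suzuki (s + 2))
    have hY := hE.comp_mul (1 - 4 * suzuki (s + 2))
    obtain ⟨h, hh, hW⟩ := (((hX.mul hjm hX).mul hjm hY).mul hjm hX).mul hjm hX
    -- Suzuki's constant removes order 2s + 3, and symmetry then removes the even order 2s + 4.
    refine expansion_of_symmetric (m := 2 * s + 4) ⟨s + 2, by ring⟩ (by omega) hh
      (fun t => ?_) (hsym _)
    have := hW t
    have e2 := suzuki_pow s
    rw [show ∀ x : ℝ, 1 * x ^ 1 + 1 * x ^ 1 + 1 * (1 - 4 * x) ^ 1 + 1 * x ^ 1 + 1 * x ^ 1 = 1 by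
        intros; ring,
      show ∀ x : ℝ, 1 * x ^ (2 * s + 3) + 1 * x ^ (2 * s + 3) + 1 * (1 - 4 * x) ^ (2 * s + 3)
        + 1 * x ^ (2 * s + 3) + 1 * x ^ (2 * s + 3)
        = 4 * x ^ (2 * s + 3) + (1 - 4 * x) ^ (2 * s + 3) by intros; ring, e2] at this
    simp only [groupTrotter, map_mul]
    refine this.trans ?_
    simp only [one_mul, pow_one]
    module

end Order

/-! ### Perturbation of the product formulas in a unitary group -/

section Perturbation

variable {A : Type*} [NormedRing A] [StarRing A] [CStarRing A]

/-- Telescoping uv - u'v' = (u - u')v + u'(v - v'); multiplication by a unitary preserves the norm.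
-/
lemma norm_unitary_mul_sub_mul_le (u u' v v' : unitary A) :
    ‖((u * v : unitary A) : A) - ((u' * v' : unitary A) : A)‖
      ≤ ‖(u : A) - u'‖ + ‖(v : A) - v'‖ := by
  have e : ((u * v : unitary A) : A) - ((u' * v' : unitary A) : A)
      = ((u : A) - u') * (v : A) + (u' : A) * ((v : A) - v') := by
    simp only [Submonoid.coe_mul]
    noncomm_ring
  rw [e]
  refine (norm_add_le _ _).trans_eq ?_
  rw [CStarRing.norm_mul_coe_unitary, CStarRing.norm_coe_unitary_mul]

lemma norm_unitary_mul_sub_mul_le_of_le {u u' v v' : unitary A} {x y : ℝ}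
    (hu : ‖(u : A) - u'‖ ≤ x) (hv : ‖(v : A) - v'‖ ≤ y) :
    ‖((u * v : unitary A) : A) - ((u' * v' : unitary A) : A)‖ ≤ x + y :=
  (norm_unitary_mul_sub_mul_le u u' v v').trans (add_le_add hu hv)

lemma norm_unitary_inv_sub_inv (u v : unitary A) :
    ‖((u⁻¹ : unitary A) : A) - ((v⁻¹ : unitary A) : A)‖ = ‖(u : A) - v‖ := by
  rw [← norm_star ((u : A) - v), star_sub]
  rfl

lemma norm_unitary_sub_le_two [Nontrivial A] (u v : unitary A) : ‖(u : A) - v‖ ≤ 2 := by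
  refine (norm_sub_le _ _).trans_eq ?_
  rw [CStarRing.norm_coe_unitary, CStarRing.norm_coe_unitary]
  norm_num

/-- A common bound for the amplification of errors by the BCH product formula. -/
def bchAmp (r : ℝ) : ℕ → ℝ
  | 0 => 0
  | 1 => 4
  | q + 2 => bchAmp r (q + 1) * (4 * |bchGamma (q + 1)| ^ r + 2 * |bchBeta (q + 1)| ^ r)

/-- A common bound for the amplification of errors by the Trotter-Suzuki product formula. -/
def trotterAmp (r : ℝ) : ℕ → ℝ
  | 0 => 0
  | 1 => 4 * (1 / 2) ^ r
  | s + 2 => trotterAmp r (s + 1) * (4 * |suzuki (s + 2)| ^ r + |1 - 4 * suzuki (s + 2)| ^ r)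

lemma bchAmp_nonneg (r : ℝ) (q : ℕ) : 0 ≤ bchAmp r q := by
  induction q with
  | zero => simp [bchAmp]
  | succ q ih =>
    cases q with
    | zero => simp [bchAmp]
    | succ q => exact mul_nonneg ih (by positivity)

lemma trotterAmp_nonneg (r : ℝ) (q : ℕ) : 0 ≤ trotterAmp r q := by
  induction q with
  | zero => simp [trotterAmp]
  | succ q ih =>
    cases q with
    | zero => simp only [trotterAmp]; positivity
    | succ q => exact mul_nonneg ih (by positivity)

variable {U U' V V' : ℝ → unitary A} {c r : ℝ}

lemma norm_groupBch_sub_le (hU : ∀ t, ‖(U t : A) - U' t‖ ≤ c * |t| ^ r)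
    (hV : ∀ t, ‖(V t : A) - V' t‖ ≤ c * |t| ^ r) (q : ℕ) (t : ℝ) :
    ‖((groupBch q U V t : unitary A) : A) - (groupBch q U' V' t : unitary A)‖
      ≤ bchAmp r q * c * |t| ^ r := by
  induction q generalizing t with
  | zero => simp [groupBch, bchAmp]
  | succ q ih =>
    cases q with
    | zero =>
      have h1 := hU (-t)
      have h2 := hV (-t)
      rw [abs_neg] at h1 h2
      refine (norm_unitary_mul_sub_mul_le_of_le (norm_unitary_mul_sub_mul_le_of_le
        (norm_unitary_mul_sub_mul_le_of_le (hU t) (hV t)) h1) h2).trans_eq ?_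
      simp only [bchAmp]
      ring
    | succ q =>
      have h1 := ih (bchGamma (q + 1) * t)
      have h2 := ih (-(bchGamma (q + 1) * t))
      have h3 := ih (bchBeta (q + 1) * t)
      have h4 := ih (-(bchBeta (q + 1) * t))
      rw [← norm_unitary_inv_sub_inv] at h3 h4
      rw [abs_neg] at h2 h4
      rw [abs_mul, Real.mul_rpow (abs_nonneg _) (abs_nonneg _)] at h1 h2 h3 h4
      refine (norm_unitary_mul_sub_mul_le_of_le (norm_unitary_mul_sub_mul_le_of_le
        (norm_unitary_mul_sub_mul_le_of_le (norm_unitary_mul_sub_mul_le_of_le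
        (norm_unitary_mul_sub_mul_le_of_le h1 h2) h3) h4) h1) h2).trans_eq ?_
      simp only [bchAmp]
      ring

lemma norm_groupTrotter_sub_le (hU : ∀ t, ‖(U t : A) - U' t‖ ≤ c * |t| ^ r)
    (hV : ∀ t, ‖(V t : A) - V' t‖ ≤ c * |t| ^ r) (s : ℕ) (t : ℝ) :
    ‖((groupTrotter s U V t : unitary A) : A) - (groupTrotter s U' V' t : unitary A)‖
      ≤ trotterAmp r s * c * |t| ^ r := by
  induction s generalizing t with
  | zero => simp [groupTrotter, trotterAmp]
  | succ s ih =>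
    cases s with
    | zero =>
      have h1 := hU (t / 2)
      have h2 := hV (t / 2)
      rw [div_eq_mul_one_div, abs_mul, mul_comm |t|, Real.mul_rpow (abs_nonneg _) (abs_nonneg _),
        abs_of_pos (one_half_pos (α := ℝ)), ← div_eq_mul_one_div] at h1 h2
      refine (norm_unitary_mul_sub_mul_le_of_le (norm_unitary_mul_sub_mul_le_of_le
        (norm_unitary_mul_sub_mul_le_of_le h1 h2) h2) h1).trans_eq ?_
      simp only [trotterAmp]
      ring
    | succ s =>
      have h1 := ih (suzuki (s + 2) * t)
      have h2 := ih ((1 - 4 * suzuki (s + 2)) * t)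
      rw [abs_mul, Real.mul_rpow (abs_nonneg _) (abs_nonneg _)] at h1 h2
      refine (norm_unitary_mul_sub_mul_le_of_le (norm_unitary_mul_sub_mul_le_of_le
        (norm_unitary_mul_sub_mul_le_of_le (norm_unitary_mul_sub_mul_le_of_le h1 h1) h2)
        h1) h1).trans_eq ?_
      simp only [trotterAmp]
      ring

end Perturbation

/-! ### Error bounds that are uniform in the cutoff -/

section Uniform

open scoped ENNReal

variable {ι : Type*} {B : ι → Type*} [∀ i, NormedRing (B i)] [∀ i, StarRing (B i)]
  [∀ i, CStarRing (B i)] [∀ i, Nontrivial (B i)]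

lemma memℓp_unitary (u : ∀ i, unitary (B i)) : Memℓp (fun i => (u i : B i)) ∞ :=
  memℓp_infty ⟨1, by rintro _ ⟨i, rfl⟩; exact (CStarRing.norm_coe_unitary _).le⟩

/-- A family of unitaries as a bounded family of operators. -/
def unitaryLp : (∀ i, unitary (B i)) →* lp B ∞ where
  toFun u := ⟨fun i => (u i : B i), memℓp_unitary u⟩
  map_one' := rfl
  map_mul' _ _ := rfl

/-- Evaluation of a bounded family of operators. -/
def evalLp (i : ι) : lp B ∞ →+* B i where
  toFun f := f i
  map_one' := rfl
  map_mul' _ _ := rfl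
  map_zero' := rfl
  map_add' _ _ := rfl

lemma continuous_evalLp (i : ι) : Continuous (evalLp (B := B) i) :=
  (AddMonoidHomClass.lipschitz_of_bound (evalLp (B := B) i) 1 (fun f => by
    rw [one_mul]; exact lp.norm_apply_le_norm (by simp) f i)).continuous

variable [∀ i, NormedAlgebra ℝ (B i)]

/-- The sup norm makes continuity of g at 0 a bound for all indices at once on some |t| < δ. For |t|
≥ δ the trivial bound 2 is at most (2/δ^m)|t|^m. -/
lemma exists_uniform_bound {W T : ℝ → ∀ i, unitary (B i)} {m : ℕ} {g : ℝ → lp B ∞}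
    (hg : AnalyticAt ℝ g 0) (h : ∀ t, unitaryLp (W t) = unitaryLp (T t) + t ^ m • g t) :
    ∃ K : ℝ, 0 ≤ K ∧ ∀ t i, ‖(W t i : B i) - T t i‖ ≤ K * |t| ^ m := by
  have h1 : ∀ᶠ t in nhds (0 : ℝ), ‖g t‖ < ‖g 0‖ + 1 :=
    hg.continuousAt.norm.eventually_lt_const (by linarith)
  obtain ⟨δ, hδ, hb⟩ := Metric.eventually_nhds_iff.mp h1
  refine ⟨max (‖g 0‖ + 1) (2 / δ ^ m), le_max_of_le_left (by positivity), fun t i => ?_⟩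
  rcases lt_or_ge |t| δ with ht | ht
  · have e : (W t i : B i) - T t i = (t ^ m • g t) i := by
      have := congrArg (fun f : lp B ∞ => f i) (h t)
      rw [sub_eq_iff_eq_add']
      exact this
    rw [e]
    refine (lp.norm_apply_le_norm (by simp) _ i).trans ?_
    rw [norm_smul, norm_pow, Real.norm_eq_abs, mul_comm]
    gcongr
    exact (hb (by simpa using ht)).le.trans (le_max_left _ _)
  · calc _ ≤ 2 := norm_unitary_sub_le_two _ _
      _ = 2 / δ ^ m * δ ^ m := by field_simp
      _ ≤ _ := by gcongr; exact le_max_right _ _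

variable [∀ i, CompleteSpace (B i)]

/-- Evaluation at an index is a continuous ring homomorphism, so it commutes with the exponential
series. -/
lemma unitaryLp_eq_exp {U : ∀ i, unitary (B i)} {a : lp B ∞}
    (hU : ∀ i, (U i : B i) = NormedSpace.exp (a i)) : unitaryLp U = NormedSpace.exp a := by
  let _ : NormedAlgebra ℚ (lp B ∞) := NormedAlgebra.restrictScalars ℚ ℝ _
  refine lp.ext (funext fun i => (hU i).trans ?_)
  let _ : NormedAlgebra ℚ (B i) := NormedAlgebra.restrictScalars ℚ ℝ _
  exact (NormedSpace.map_exp (evalLp i) (continuous_evalLp i) a).symm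

variable {U V T : ℝ → ∀ i, unitary (B i)} {a b : lp B ∞}

lemma exists_uniform_groupBch_bound
    (hU : ∀ t i, (U t i : B i) = NormedSpace.exp (t • a i))
    (hV : ∀ t i, (V t i : B i) = NormedSpace.exp (t • b i))
    (hT : ∀ t i, (T t i : B i) = NormedSpace.exp (t • (a i * b i - b i * a i)))
    (hU' : ∀ t, U (-t) = (U t)⁻¹) (hV' : ∀ t, V (-t) = (V t)⁻¹) (q : ℕ) :
    ∃ K : ℝ, 0 ≤ K ∧ ∀ t i,
      ‖((groupBch (q + 1) (fun s => U s i) (fun s => V s i) t : unitary (B i)) : B i)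
        - T (t ^ 2) i‖ ≤ K * |t| ^ (2 * q + 3) := by
  obtain ⟨g, hg, h⟩ := groupBch_expansion (ρ := unitaryLp) (a := a) (b := b)
    (fun t => unitaryLp_eq_exp (hU t)) (fun t => unitaryLp_eq_exp (hV t)) hU' hV' q
  obtain ⟨K, hK, hb⟩ := exists_uniform_bound (T := fun t => T (t ^ 2)) hg (fun t => by
    rw [h t, unitaryLp_eq_exp (a := t ^ 2 • (a * b - b * a)) (hT (t ^ 2))])
  refine ⟨K, hK, fun t i => ?_⟩
  have e := map_groupBch (Pi.evalMonoidHom (fun i => unitary (B i)) i) (q + 1) U V t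
  simp only [Pi.evalMonoidHom_apply] at e
  rw [← e]
  exact hb t i

lemma exists_uniform_groupTrotter_bound
    (hU : ∀ t i, (U t i : B i) = NormedSpace.exp (t • a i))
    (hV : ∀ t i, (V t i : B i) = NormedSpace.exp (t • b i))
    (hT : ∀ t i, (T t i : B i) = NormedSpace.exp (t • (a i + b i)))
    (hU' : ∀ t, U (-t) = (U t)⁻¹) (hV' : ∀ t, V (-t) = (V t)⁻¹) (s : ℕ) :
    ∃ K : ℝ, 0 ≤ K ∧ ∀ t i,
      ‖((groupTrotter (s + 1) (fun s => U s i) (fun s => V s i) t : unitary (B i)) : B i)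
        - T t i‖ ≤ K * |t| ^ (2 * s + 3) := by
  obtain ⟨g, hg, h⟩ := groupTrotter_expansion (ρ := unitaryLp) (a := a) (b := b)
    (fun t => unitaryLp_eq_exp (hU t)) (fun t => unitaryLp_eq_exp (hV t)) hU' hV' s
  obtain ⟨K, hK, hb⟩ := exists_uniform_bound (T := T) hg (fun t => by
    rw [h t, unitaryLp_eq_exp (a := t • (a + b)) (hT t)])
  refine ⟨K, hK, fun t i => ?_⟩
  have e := map_groupTrotter (Pi.evalMonoidHom (fun i => unitary (B i)) i) (s + 1) U V t
  simp only [Pi.evalMonoidHom_apply] at e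
  rw [← e]
  exact hb t i

end Uniform

/-! ### One-parameter unitary groups and self-adjoint commutators -/

section ExpFamily

variable {A : Type*} [NormedRing A] [StarRing A] [NormedAlgebra ℂ A] [StarModule ℂ A]

/-- The self-adjoint element `i [M, N]`. -/
def commutatorSA (M N : selfAdjoint A) : selfAdjoint A :=
  ⟨Complex.I • ((M : A) * N - N * M), by
    rw [selfAdjoint.mem_iff, star_smul, star_sub, star_mul, star_mul, M.2.star_eq, N.2.star_eq,
      ← neg_sub, smul_neg, Complex.star_def, Complex.conj_I, neg_smul, neg_neg]⟩

lemma coe_commutatorSA (M N : selfAdjoint A) :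
    Complex.I • (commutatorSA M N : A) = (Complex.I • (M : A)) * (Complex.I • (N : A))
      - (Complex.I • (N : A)) * (Complex.I • (M : A)) := by
  simp only [commutatorSA, smul_mul_assoc, mul_smul_comm, smul_sub]

lemma commutatorSA_smul (M N : selfAdjoint A) (c : ℝ) :
    commutatorSA (c • M) (c • N) = c ^ 2 • commutatorSA M N := by
  ext
  simp only [commutatorSA, selfAdjoint.val_smul, smul_mul_assoc, mul_smul_comm, smul_sub, pow_two,
    mul_smul, smul_comm c Complex.I]

variable [CStarRing A] [CompleteSpace A]

/-- The one-parameter unitary group `t ↦ exp (i t M)`. -/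
def expFamily (M : selfAdjoint A) (t : ℝ) : unitary A := selfAdjoint.expUnitary (t • M)

lemma coe_expFamily (M : selfAdjoint A) (t : ℝ) :
    (expFamily M t : A) = NormedSpace.exp (t • Complex.I • (M : A)) := by
  rw [expFamily, selfAdjoint.expUnitary_coe, selfAdjoint.val_smul, smul_comm]

lemma expFamily_neg (M : selfAdjoint A) (t : ℝ) : expFamily M (-t) = (expFamily M t)⁻¹ := by
  rw [eq_inv_iff_mul_eq_one]
  ext
  rw [Submonoid.coe_mul, coe_expFamily, coe_expFamily, exp_smul_mul_exp_smul, neg_add_cancel,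
    exp_zero_smul]
  rfl

lemma expFamily_zero (M : selfAdjoint A) : expFamily M 0 = 1 := by
  ext
  rw [coe_expFamily, exp_zero_smul]
  rfl

lemma expFamily_smul (M : selfAdjoint A) (c t : ℝ) : expFamily (c • M) t = expFamily M (c * t) := by
  rw [expFamily, expFamily, smul_smul, mul_comm]

lemma coe_expFamily_commutatorSA (M N : selfAdjoint A) (t : ℝ) :
    (expFamily (commutatorSA M N) t : A)
      = NormedSpace.exp (t • ((Complex.I • (M : A)) * (Complex.I • (N : A))
      - (Complex.I • (N : A)) * (Complex.I • (M : A)))) := by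
  rw [coe_expFamily, coe_commutatorSA]

lemma coe_expFamily_add (M N : selfAdjoint A) (t : ℝ) :
    (expFamily (M + N) t : A)
      = NormedSpace.exp (t • (Complex.I • (M : A) + Complex.I • (N : A))) := by
  rw [coe_expFamily, AddSubgroup.coe_add, smul_add]

end ExpFamily

/-! ### Compatibility of the product formulas with rescaling of time -/

section Rescaling

variable {G : Type*} [Group G]

lemma groupBch_comp_mul (q : ℕ) (U V : ℝ → G) (c t : ℝ) :
    groupBch q (fun s => U (c * s)) (fun s => V (c * s)) t = groupBch q U V (c * t) := by
  induction q generalizing t with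
  | zero => simp [groupBch]
  | succ q ih =>
    cases q with
    | zero => simp [groupBch]
    | succ q => simp only [groupBch, ih, mul_neg, mul_left_comm c]

lemma groupTrotter_comp_mul (q : ℕ) (U V : ℝ → G) (c t : ℝ) :
    groupTrotter q (fun s => U (c * s)) (fun s => V (c * s)) t = groupTrotter q U V (c * t) := by
  induction q generalizing t with
  | zero => simp [groupTrotter]
  | succ q ih =>
    cases q with
    | zero => simp [groupTrotter, mul_div_assoc]
    | succ q => simp only [groupTrotter, ih, mul_left_comm c]

end Rescaling

/-! ### Error bounds for exact exponentials, with constants independent of cutoff and generators -/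

section UniformOrder

open scoped ENNReal

/-- Pairs of self-adjoint contractions, for all cutoffs at once. -/
abbrev ContractionPair : Type :=
  {x : Σ Λ : ℕ, selfAdjoint (Op Λ) × selfAdjoint (Op Λ) // ‖x.2.1‖ ≤ 1 ∧ ‖x.2.2‖ ≤ 1}

lemma memℓp_generator {M : ∀ i : ContractionPair, selfAdjoint (Op i.1.1)} (hM : ∀ i, ‖M i‖ ≤ 1) :
    Memℓp (fun i => Complex.I • (M i : Op i.1.1)) ∞ := by
  refine memℓp_infty ⟨1, ?_⟩
  rintro _ ⟨i, rfl⟩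
  simpa [norm_smul] using hM i

lemma exists_groupBch_bound_of_contraction (q : ℕ) :
    ∃ K : ℝ, 0 ≤ K ∧ ∀ (Λ : ℕ) (M N : selfAdjoint (Op Λ)), ‖M‖ ≤ 1 → ‖N‖ ≤ 1 → ∀ t : ℝ,
      ‖((groupBch (q + 1) (expFamily M) (expFamily N) t : unitary (Op Λ)) : Op Λ)
        - expFamily (commutatorSA M N) (t ^ 2)‖ ≤ K * |t| ^ (2 * q + 3) := by
  obtain ⟨K, hK, hb⟩ := exists_uniform_groupBch_bound (B := fun i : ContractionPair => Op i.1.1)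
    (U := fun t i => expFamily i.1.2.1 t) (V := fun t i => expFamily i.1.2.2 t)
    (T := fun t i => expFamily (commutatorSA i.1.2.1 i.1.2.2) t)
    (a := ⟨_, memℓp_generator (M := fun i => i.1.2.1) (fun i => i.2.1)⟩)
    (b := ⟨_, memℓp_generator (M := fun i => i.1.2.2) (fun i => i.2.2)⟩)
    (fun t i => coe_expFamily _ _) (fun t i => coe_expFamily _ _)
    (fun t i => coe_expFamily_commutatorSA _ _ _)
    (fun t => funext fun i => expFamily_neg _ _) (fun t => funext fun i => expFamily_neg _ _) q
  exact ⟨K, hK, fun Λ M N h1 h2 t => hb t ⟨⟨Λ, M, N⟩, h1, h2⟩⟩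

lemma exists_groupTrotter_bound_of_contraction (s : ℕ) :
    ∃ K : ℝ, 0 ≤ K ∧ ∀ (Λ : ℕ) (M N : selfAdjoint (Op Λ)), ‖M‖ ≤ 1 → ‖N‖ ≤ 1 → ∀ t : ℝ,
      ‖((groupTrotter (s + 1) (expFamily M) (expFamily N) t : unitary (Op Λ)) : Op Λ)
        - expFamily (M + N) t‖ ≤ K * |t| ^ (2 * s + 3) := by
  obtain ⟨K, hK, hb⟩ := exists_uniform_groupTrotter_bound
    (B := fun i : ContractionPair => Op i.1.1)
    (U := fun t i => expFamily i.1.2.1 t) (V := fun t i => expFamily i.1.2.2 t)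
    (T := fun t i => expFamily (i.1.2.1 + i.1.2.2) t)
    (a := ⟨_, memℓp_generator (M := fun i => i.1.2.1) (fun i => i.2.1)⟩)
    (b := ⟨_, memℓp_generator (M := fun i => i.1.2.2) (fun i => i.2.2)⟩)
    (fun t i => coe_expFamily _ _) (fun t i => coe_expFamily _ _)
    (fun t i => coe_expFamily_add _ _ _)
    (fun t => funext fun i => expFamily_neg _ _) (fun t => funext fun i => expFamily_neg _ _) s
  exact ⟨K, hK, fun Λ M N h1 h2 t => hb t ⟨⟨Λ, M, N⟩, h1, h2⟩⟩

/-- Lowers the integer order m to a real order r: for x ≤ 1 powers decrease in the exponent, and for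
x ≥ 1 the trivial bound 2 suffices. -/
lemma norm_sub_le_of_norm_sub_le_pow {Λ : ℕ} {u v : unitary (Op Λ)} {K x r : ℝ} {m : ℕ}
    (h : ‖(u : Op Λ) - v‖ ≤ K * x ^ m) (hK : 0 ≤ K) (hx : 0 ≤ x) (hr : 0 ≤ r) (hrm : r ≤ m) :
    ‖(u : Op Λ) - v‖ ≤ (K + 2) * x ^ r := by
  rcases le_total x 1 with h1 | h1
  · refine h.trans ?_
    rw [← Real.rpow_natCast]
    have : x ^ (m : ℝ) ≤ x ^ r := Real.rpow_le_rpow_of_exponent_ge' hx h1 hr hrm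
    have h0 : 0 ≤ x ^ (m : ℝ) := by positivity
    nlinarith
  · have : 1 ≤ x ^ r := Real.one_le_rpow h1 hr
    have := norm_unitary_sub_le_two u v
    nlinarith

theorem exists_groupBch_bound (q : ℕ) :
    ∃ K : ℝ, 0 ≤ K ∧ ∀ (Λ : ℕ) (M N : selfAdjoint (Op Λ)) (ν r : ℝ), 0 < ν → ‖M‖ ≤ ν → ‖N‖ ≤ ν →
      0 ≤ r → r ≤ 2 * q + 3 → ∀ t : ℝ,
      ‖((groupBch (q + 1) (expFamily M) (expFamily N) t : unitary (Op Λ)) : Op Λ)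
        - expFamily (commutatorSA M N) (t ^ 2)‖ ≤ K * (ν * |t|) ^ r := by
  obtain ⟨K, hK, h⟩ := exists_groupBch_bound_of_contraction q
  refine ⟨K + 2, by positivity, fun Λ M N ν r hν hM hN hr hrm t => ?_⟩
  refine norm_sub_le_of_norm_sub_le_pow (m := 2 * q + 3) ?_ hK (by positivity) hr
    (by exact_mod_cast hrm)
  -- The rescaled generators are contractions, and running them for time νt reproduces the original
  -- evolution.
  have h1 := h Λ (ν⁻¹ • M) (ν⁻¹ • N)
    (by rw [norm_smul, norm_inv, Real.norm_of_nonneg hν.le]; field_simp; exact hM)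
    (by rw [norm_smul, norm_inv, Real.norm_of_nonneg hν.le]; field_simp; exact hN) (ν * t)
  rw [commutatorSA_smul, expFamily_smul, ← groupBch_comp_mul] at h1
  simp only [expFamily_smul, inv_mul_cancel_left₀ hν.ne'] at h1
  rwa [← mul_pow, inv_mul_cancel_left₀ hν.ne', abs_mul, abs_of_pos hν] at h1

theorem exists_groupTrotter_bound (s : ℕ) :
    ∃ K : ℝ, 0 ≤ K ∧ ∀ (Λ : ℕ) (M N : selfAdjoint (Op Λ)) (ν r : ℝ), 0 < ν → ‖M‖ ≤ ν → ‖N‖ ≤ ν →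
      0 ≤ r → r ≤ 2 * s + 3 → ∀ t : ℝ,
      ‖((groupTrotter (s + 1) (expFamily M) (expFamily N) t : unitary (Op Λ)) : Op Λ)
        - expFamily (M + N) t‖ ≤ K * (ν * |t|) ^ r := by
  obtain ⟨K, hK, h⟩ := exists_groupTrotter_bound_of_contraction s
  refine ⟨K + 2, by positivity, fun Λ M N ν r hν hM hN hr hrm t => ?_⟩
  refine norm_sub_le_of_norm_sub_le_pow (m := 2 * s + 3) ?_ hK (by positivity) hr
    (by exact_mod_cast hrm)
  have h1 := h Λ (ν⁻¹ • M) (ν⁻¹ • N)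
    (by rw [norm_smul, norm_inv, Real.norm_of_nonneg hν.le]; field_simp; exact hM)
    (by rw [norm_smul, norm_inv, Real.norm_of_nonneg hν.le]; field_simp; exact hN) (ν * t)
  rw [← smul_add, expFamily_smul, ← groupTrotter_comp_mul] at h1
  simp only [expFamily_smul, inv_mul_cancel_left₀ hν.ne'] at h1
  rwa [abs_mul, abs_of_pos hν] at h1

end UniformOrder

/-! ### Conjugation of generators by unitaries -/

section Conjugation

variable {A : Type*} [NormedRing A] [StarRing A]

/-- Conjugation of a self-adjoint element by a unitary. -/
def conjSA (g : unitary A) (M : selfAdjoint A) : selfAdjoint A :=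
  ⟨g * M * star (g : A), M.2.conjugate (g : A)⟩

lemma norm_conjSA [CStarRing A] (g : unitary A) (M : selfAdjoint A) : ‖conjSA g M‖ = ‖M‖ := by
  change ‖(g : A) * M * star (g : A)‖ = ‖(M : A)‖
  rw [← Unitary.coe_star, CStarRing.norm_mul_coe_unitary, CStarRing.norm_coe_unitary_mul]

variable [NormedAlgebra ℂ A] [StarModule ℂ A]

lemma norm_commutatorSA_le {M N : selfAdjoint A} {ν : ℝ} (hM : ‖M‖ ≤ ν) (hN : ‖N‖ ≤ ν) :
    ‖commutatorSA M N‖ ≤ 2 * ν ^ 2 := by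
  change ‖Complex.I • ((M : A) * N - N * M)‖ ≤ _
  have hν : 0 ≤ ν := (norm_nonneg M).trans hM
  have hM' : ‖(M : A)‖ ≤ ν := hM
  have hN' : ‖(N : A)‖ ≤ ν := hN
  rw [norm_smul, Complex.norm_I, one_mul]
  refine (norm_sub_le _ _).trans ?_
  have h1 : ‖(M : A) * N‖ ≤ ν * ν := norm_mul_le_of_le hM' hN'
  have h2 : ‖(N : A) * M‖ ≤ ν * ν := norm_mul_le_of_le hN' hM'
  linarith

variable [CStarRing A] [CompleteSpace A]

lemma conj_expFamily (g : unitary A) (M : selfAdjoint A) (t : ℝ) :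
    g * expFamily M t * g⁻¹ = expFamily (conjSA g M) t := by
  let _ : NormedAlgebra ℚ A := NormedAlgebra.restrictScalars ℚ ℝ A
  ext
  rw [Submonoid.coe_mul, Submonoid.coe_mul, coe_expFamily, coe_expFamily]
  have h := NormedSpace.exp_units_conj (Unitary.toUnits g) (t • Complex.I • (M : A))
  refine h.symm.trans ?_
  congr 1
  change (g : A) * (t • Complex.I • (M : A)) * star (g : A)
    = t • Complex.I • ((g : A) * M * star (g : A))
  simp only [mul_smul_comm, smul_mul_assoc]

end Conjugation

/-! ### Circuits as unitaries -/

lemma blockHam_isHermitian (Λ k : ℕ) : (blockHam Λ k)ᴴ = blockHam Λ k := by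
  simp [blockHam, creation, Matrix.fromBlocks_conjTranspose, Matrix.conjTranspose_pow]

/-- The self-adjoint generator of `target`. -/
def hamSA (Λ k : ℕ) : selfAdjoint (Op Λ) := ⟨blockHam Λ k, blockHam_isHermitian Λ k⟩

lemma coe_expFamily_hamSA (Λ k : ℕ) (t : ℝ) :
    (expFamily (hamSA Λ k) t : Op Λ) = target Λ k t := by
  rw [coe_expFamily, target, mul_comm, mul_smul, Complex.coe_smul]
  rfl

lemma sqrt_two_inv_mul_self :
    (((Real.sqrt 2)⁻¹ : ℝ) : ℂ) * (((Real.sqrt 2)⁻¹ : ℝ) : ℂ) = 1 / 2 := by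
  rw [← Complex.ofReal_mul, ← mul_inv, Real.mul_self_sqrt (by norm_num)]
  norm_num

lemma qubitOp_mul (Λ : ℕ) (α β γ δ α' β' γ' δ' : ℂ) :
    qubitOp Λ α β γ δ * qubitOp Λ α' β' γ' δ'
      = qubitOp Λ (α * α' + β * γ') (α * β' + β * δ') (γ * α' + δ * γ') (γ * β' + δ * δ') := by
  simp [qubitOp, Matrix.fromBlocks_multiply, smul_smul, add_smul, mul_comm]

lemma qubitOp_one (Λ : ℕ) : qubitOp Λ 1 0 0 1 = 1 := by
  simp [qubitOp]

lemma star_qubitOp (Λ : ℕ) (α β γ δ : ℂ) :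
    star (qubitOp Λ α β γ δ) = qubitOp Λ (star α) (star γ) (star β) (star δ) := by
  simp [qubitOp, Matrix.star_eq_conjTranspose, Matrix.fromBlocks_conjTranspose]

lemma gate_inv_mat (Λ : ℕ) (g : Gate) : g.inv.mat Λ = star (g.mat Λ) := by
  cases g with
  | s1 t =>
    change target Λ 1 (-t) = star (target Λ 1 t)
    rw [← coe_expFamily_hamSA, ← coe_expFamily_hamSA, expFamily_neg]
    rfl
  | x => simp [Gate.inv, Gate.mat, star_qubitOp]
  | h => simp [Gate.inv, Gate.mat, star_qubitOp]
  | s => simp [Gate.inv, Gate.mat, star_qubitOp]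
  | sdg => simp [Gate.inv, Gate.mat, star_qubitOp]

lemma gate_mat_mul_inv (Λ : ℕ) (g : Gate) : g.mat Λ * g.inv.mat Λ = 1 := by
  have h := sqrt_two_inv_mul_self
  cases g with
  | s1 t =>
    change target Λ 1 t * target Λ 1 (-t) = 1
    rw [← coe_expFamily_hamSA, ← coe_expFamily_hamSA, expFamily_neg, ← Submonoid.coe_mul,
      mul_inv_cancel]
    rfl
  | x => simp [Gate.inv, Gate.mat, qubitOp_mul, qubitOp_one]
  | h =>
    simp only [Gate.inv, Gate.mat, qubitOp_mul, mul_neg, neg_mul, neg_neg, h]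
    rw [← qubitOp_one]
    congr 1 <;> norm_num
  | s => simp [Gate.inv, Gate.mat, qubitOp_mul, qubitOp_one]
  | sdg => simp [Gate.inv, Gate.mat, qubitOp_mul, qubitOp_one]

/-- The gate as a unitary. -/
def gateU (Λ : ℕ) (g : Gate) : unitary (Op Λ) :=
  ⟨g.mat Λ, Matrix.mem_unitaryGroup_iff.mpr (by rw [← gate_inv_mat, gate_mat_mul_inv])⟩

lemma gateU_inv (Λ : ℕ) (g : Gate) : gateU Λ g.inv = (gateU Λ g)⁻¹ :=
  Subtype.ext (gate_inv_mat Λ g)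

/-- The circuit as a unitary. -/
def circU (Λ : ℕ) (c : Circuit) : unitary (Op Λ) := (c.map (gateU Λ)).prod

lemma coe_circU (Λ : ℕ) (c : Circuit) : (circU Λ c : Op Λ) = c.eval Λ := by
  induction c with
  | nil => rfl
  | cons g c ih =>
    simp only [circU, Circuit.eval, List.map_cons, List.prod_cons, Submonoid.coe_mul] at ih ⊢
    rw [ih]
    rfl

lemma circU_append (Λ : ℕ) (c d : Circuit) : circU Λ (c ++ d) = circU Λ c * circU Λ d := by
  simp [circU]

lemma circU_inv (Λ : ℕ) (c : Circuit) : circU Λ c.inv = (circU Λ c)⁻¹ := by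
  induction c with
  | nil => simp [circU, Circuit.inv]
  | cons g c ih =>
    have h1 : Circuit.inv (g :: c) = Circuit.inv c ++ [g.inv] := by simp [Circuit.inv]
    rw [h1, circU_append, ih]
    simp [circU, gateU_inv]

lemma circU_bch (Λ q : ℕ) (U V : ℝ → Circuit) (t : ℝ) :
    circU Λ (bch q U V t) = groupBch q (fun s => circU Λ (U s)) (fun s => circU Λ (V s)) t := by
  induction q generalizing t with
  | zero => simp [bch, groupBch, circU]
  | succ q ih =>
    cases q with
    | zero => simp only [bch, groupBch, circU_append]
    | succ q => simp only [bch, groupBch, circU_append, circU_inv, ih]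

lemma circU_trotter (Λ s : ℕ) (U V : ℝ → Circuit) (t : ℝ) :
    circU Λ (trotter s U V t)
      = groupTrotter s (fun s => circU Λ (U s)) (fun s => circU Λ (V s)) t := by
  induction s generalizing t with
  | zero => simp [trotter, groupTrotter, circU]
  | succ s ih =>
    cases s with
    | zero => simp only [trotter, groupTrotter, circU_append]
    | succ s => simp only [trotter, groupTrotter, circU_append, ih]

/-! ### Approximation of one-parameter groups by circuit families -/

/-- The family `U` implements `t ↦ exp (i t M)` up to an error of order `p` in `ν t`, uniformly in
the cutoff. -/
structure Approx (U : ℝ → Circuit) (M : ∀ Λ, selfAdjoint (Op Λ)) (ν : ℕ → ℝ) (p : ℝ) : Prop where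
  neg : ∀ Λ t, circU Λ (U (-t)) = (circU Λ (U t))⁻¹
  zero : ∀ Λ, circU Λ (U 0) = 1
  bound : ∃ C : ℝ, 0 ≤ C ∧ ∀ Λ, 1 ≤ Λ → ∀ t,
    ‖(circU Λ (U t) : Op Λ) - expFamily (M Λ) t‖ ≤ C * (ν Λ * |t|) ^ p

lemma Approx.conj {U : ℝ → Circuit} {M : ∀ Λ, selfAdjoint (Op Λ)} {ν : ℕ → ℝ} {p : ℝ}
    (h : Approx U M ν p) (c : Circuit) :
    Approx (fun t => c ++ U t ++ c.inv) (fun Λ => conjSA (circU Λ c) (M Λ)) ν p where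
  neg Λ t := by simp [circU_append, circU_inv, h.neg, mul_assoc]
  zero Λ := by simp [circU_append, circU_inv, h.zero]
  bound := by
    obtain ⟨C, hC, hb⟩ := h.bound
    refine ⟨C, hC, fun Λ hΛ t => ?_⟩
    have := hb Λ hΛ t
    rw [circU_append, circU_append, circU_inv, ← conj_expFamily]
    refine (norm_unitary_mul_sub_mul_le_of_le
      (norm_unitary_mul_sub_mul_le_of_le (x := 0) (by simp) this) (y := 0) (by simp)).trans_eq ?_
    ring

/-- Triangle inequality through the formula applied to the exact exponentials: the input errors are
amplified by a constant, and the formula's own error is added. -/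
lemma Approx.trotter {U V : ℝ → Circuit} {M N : ∀ Λ, selfAdjoint (Op Λ)} {ν : ℕ → ℝ} {p : ℝ}
    (hU : Approx U M ν p) (hV : Approx V N ν p) (hν : ∀ Λ, 1 ≤ Λ → 0 < ν Λ)
    (hM : ∀ Λ, ‖M Λ‖ ≤ ν Λ) (hN : ∀ Λ, ‖N Λ‖ ≤ ν Λ) (hp : 0 ≤ p) {s : ℕ}
    (hs : p ≤ 2 * (s : ℝ) + 3) :
    Approx (trotter (s + 1) U V) (fun Λ => M Λ + N Λ) ν p where
  neg Λ t := by
    rw [circU_trotter, circU_trotter, groupTrotter_neg _ (hU.neg Λ) (hV.neg Λ)]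
  zero Λ := by
    rw [circU_trotter, groupTrotter_zero _ (hU.zero Λ) (hV.zero Λ)]
  bound := by
    obtain ⟨C₁, hC₁, h₁⟩ := hU.bound
    obtain ⟨C₂, hC₂, h₂⟩ := hV.bound
    obtain ⟨K, hK, hb⟩ := exists_groupTrotter_bound s
    have ha := trotterAmp_nonneg p (s + 1)
    refine ⟨trotterAmp p (s + 1) * (C₁ + C₂) + K, by positivity, fun Λ hΛ t => ?_⟩
    have hν' := (hν Λ hΛ).le
    have h3 := norm_groupTrotter_sub_le (U := fun s => circU Λ (U s)) (V := fun s => circU Λ (V s))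
      (U' := expFamily (M Λ)) (V' := expFamily (N Λ)) (c := (C₁ + C₂) * ν Λ ^ p) (r := p)
      (fun t => (h₁ Λ hΛ t).trans (by
        rw [Real.mul_rpow hν' (abs_nonneg _), ← mul_assoc]; gcongr; linarith))
      (fun t => (h₂ Λ hΛ t).trans (by
        rw [Real.mul_rpow hν' (abs_nonneg _), ← mul_assoc]; gcongr; linarith)) (s + 1) t
    have h4 := hb Λ (M Λ) (N Λ) (ν Λ) p (hν Λ hΛ) (hM Λ) (hN Λ) hp hs t
    rw [circU_trotter]
    refine (norm_sub_le_norm_sub_add_norm_sub _ _ _).trans ((add_le_add h3 h4).trans_eq ?_)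
    rw [Real.mul_rpow hν' (abs_nonneg _)]
    ring

lemma Approx.bch {U V : ℝ → Circuit} {M N : ∀ Λ, selfAdjoint (Op Λ)} {ν : ℕ → ℝ} {p : ℝ}
    (hU : Approx U M ν (2 * p)) (hV : Approx V N ν (2 * p)) (hν : ∀ Λ, 1 ≤ Λ → 0 < ν Λ)
    (hM : ∀ Λ, ‖M Λ‖ ≤ ν Λ) (hN : ∀ Λ, ‖N Λ‖ ≤ ν Λ) (hp : 0 ≤ p) {q : ℕ}
    (hq : 2 * p ≤ 2 * (q : ℝ) + 3) (c : Circuit) :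
    Approx (oddExtend fun t => c ++ bch (q + 1) U V (Real.sqrt (t / 2)) ++ c.inv)
      (fun Λ => (1 / 2 : ℝ) • conjSA (circU Λ c) (commutatorSA (M Λ) (N Λ)))
      (fun Λ => ν Λ ^ 2) p where
  neg Λ t := by
    -- At t = 0 both t and -t fall in the nonnegative branch of `oddExtend`, so the inversion rule
    -- needs the circuit to be trivial there. Inversion alone would only make the inputs involutions
    -- at 0, which is why `Approx` records the value at 0 separately.
    have h0 := groupBch_zero (q + 1) (U := fun s => circU Λ (U s)) (V := fun s => circU Λ (V s))
      (hU.zero Λ) (hV.zero Λ)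
    rcases lt_trichotomy t 0 with h | rfl | h
    · simp [oddExtend, h.le, h.not_ge, circU_inv]
    · simp [oddExtend, circU_append, circU_inv, circU_bch, h0]
    · simp [oddExtend, h.le, h.not_ge, circU_inv]
  zero Λ := by
    have h0 := groupBch_zero (q + 1) (U := fun s => circU Λ (U s)) (V := fun s => circU Λ (V s))
      (hU.zero Λ) (hV.zero Λ)
    simp [oddExtend, circU_append, circU_inv, circU_bch, h0]
  bound := by
    obtain ⟨C₁, hC₁, h₁⟩ := hU.bound
    obtain ⟨C₂, hC₂, h₂⟩ := hV.bound
    obtain ⟨K, hK, hb⟩ := exists_groupBch_bound q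
    have ha := bchAmp_nonneg (2 * p) (q + 1)
    refine ⟨bchAmp (2 * p) (q + 1) * (C₁ + C₂) + K, by positivity, fun Λ hΛ t => ?_⟩
    have hν' := (hν Λ hΛ).le
    have key : ∀ t : ℝ, 0 ≤ t →
        ‖(circU Λ (c ++ QubitBoson.bch (q + 1) U V (Real.sqrt (t / 2)) ++ c.inv) : Op Λ)
          - expFamily ((1 / 2 : ℝ) • conjSA (circU Λ c) (commutatorSA (M Λ) (N Λ))) t‖
          ≤ (bchAmp (2 * p) (q + 1) * (C₁ + C₂) + K) * (ν Λ ^ 2 * |t|) ^ p := by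
      intro t ht
      have h3 := norm_groupBch_sub_le (U := fun s => circU Λ (U s)) (V := fun s => circU Λ (V s))
        (U' := expFamily (M Λ)) (V' := expFamily (N Λ)) (c := (C₁ + C₂) * ν Λ ^ (2 * p))
        (r := 2 * p)
        (fun t => (h₁ Λ hΛ t).trans (by
          rw [Real.mul_rpow hν' (abs_nonneg _), ← mul_assoc]; gcongr; linarith))
        (fun t => (h₂ Λ hΛ t).trans (by
          rw [Real.mul_rpow hν' (abs_nonneg _), ← mul_assoc]; gcongr; linarith)) (q + 1)
        (Real.sqrt (t / 2))
      have h4 := hb Λ (M Λ) (N Λ) (ν Λ) (2 * p) (hν Λ hΛ) (hM Λ) (hN Λ) (by positivity) hq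
        (Real.sqrt (t / 2))
      have h5 := (norm_sub_le_norm_sub_add_norm_sub _ _ _).trans (add_le_add h3 h4)
      rw [Real.sq_sqrt (by positivity), ← circU_bch] at h5
      rw [circU_append, circU_append, circU_inv, expFamily_smul, ← conj_expFamily,
        one_div_mul_eq_div]
      refine (norm_unitary_mul_sub_mul_le_of_le
        (norm_unitary_mul_sub_mul_le_of_le (x := 0) (by simp) h5) (y := 0) (by simp)).trans ?_
      -- The order is halved and the scale squared here: (ν√(t/2))² = ν²t/2.
      have h6 : (ν Λ * |Real.sqrt (t / 2)|) ^ (2 * p) ≤ (ν Λ ^ 2 * |t|) ^ p := by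
        rw [Real.rpow_mul (by positivity)]
        gcongr
        rw [Real.rpow_two, mul_pow, sq_abs, Real.sq_sqrt (by positivity), abs_of_nonneg ht]
        gcongr
        linarith
      have h7 : (C₁ + C₂) * ν Λ ^ (2 * p) * |Real.sqrt (t / 2)| ^ (2 * p)
          = (C₁ + C₂) * (ν Λ * |Real.sqrt (t / 2)|) ^ (2 * p) := by
        rw [Real.mul_rpow hν' (abs_nonneg _), mul_assoc]
      rw [zero_add, add_zero, mul_assoc (bchAmp _ _), mul_assoc, ← mul_assoc (C₁ + C₂), h7,
        ← mul_assoc, ← add_mul]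
      gcongr
    rcases le_or_gt 0 t with ht | ht
    · simpa only [oddExtend, ht, if_true] using key t ht
    -- Negative times reduce to positive ones because inversion of unitaries is isometric.
    · have := key (-t) (by linarith)
      rw [expFamily_neg, ← norm_unitary_inv_sub_inv, inv_inv, abs_neg] at this
      simpa only [oddExtend, ht.not_ge, if_false, circU_inv] using this

/-! ### The Hamiltonians -/

lemma annihilation_conjTranspose_mul (Λ : ℕ) :
    (annihilation Λ)ᴴ * annihilation Λ = Matrix.diagonal fun n : Fin (Λ + 1) => ((n : ℕ) : ℂ) := by
  ext i j
  rw [Matrix.mul_apply, Matrix.diagonal_apply]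
  simp only [Matrix.conjTranspose_apply, annihilation, Matrix.of_apply]
  induction i using Fin.cases with
  | zero => simp
  | succ m =>
    rw [Finset.sum_eq_single m.castSucc]
    · by_cases h : m.succ = j
      · subst h
        simp only [Fin.val_castSucc, Fin.val_succ, if_true, Complex.star_def, Complex.conj_ofReal]
        rw [← Complex.ofReal_mul, Real.mul_self_sqrt (by positivity), Complex.ofReal_natCast]
      · have h' : ¬ (m : ℕ) + 1 = j := fun e => h (Fin.ext e)
        simp [h, h']
    · intro x _ hx
      have h' : ¬ (x : ℕ) = m := fun e => hx (Fin.ext e)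
      simp [h']
    · simp

lemma annihilation_mul_conjTranspose (Λ : ℕ) :
    annihilation Λ * (annihilation Λ)ᴴ
      = Matrix.diagonal fun n : Fin (Λ + 1) => if (n : ℕ) < Λ then ((n : ℕ) : ℂ) + 1 else 0 := by
  ext i j
  rw [Matrix.mul_apply, Matrix.diagonal_apply]
  simp only [Matrix.conjTranspose_apply, annihilation, Matrix.of_apply]
  by_cases hi : (i : ℕ) < Λ
  · rw [Finset.sum_eq_single ⟨i + 1, by omega⟩]
    · by_cases h : i = j
      · subst h
        simp only [if_true, Complex.star_def, Complex.conj_ofReal, hi]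
        rw [← Complex.ofReal_mul, Real.mul_self_sqrt (by positivity)]
        push_cast
        rfl
      · have h' : ¬ (j : ℕ) = i := fun e => h (Fin.ext e.symm)
        simp [h, h']
    · intro x _ hx
      have h' : ¬ (i : ℕ) + 1 = x := fun e => hx (Fin.ext e.symm)
      simp [h']
    · simp
  · rw [Finset.sum_eq_zero]
    · simp [hi]
    · intro x _
      have h' : ¬ (i : ℕ) + 1 = x := by omega
      simp [h']

/-- By the C*-identity the squared norm is that of diag(a†a, aa†). Both blocks are diagonal with
entries at most Λ; the truncation makes the last entry of aa† vanish instead of being Λ + 1. -/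
lemma norm_blockDiagonal_annihilation_le (Λ : ℕ) :
    ‖(Matrix.fromBlocks (annihilation Λ) 0 0 (annihilation Λ)ᴴ : Op Λ)‖ ≤ Real.sqrt Λ := by
  apply Real.le_sqrt_of_sq_le
  rw [pow_two, ← Matrix.l2_opNorm_conjTranspose_mul_self, Matrix.fromBlocks_conjTranspose,
    Matrix.fromBlocks_multiply]
  simp only [Matrix.conjTranspose_zero, Matrix.conjTranspose_conjTranspose, zero_mul, mul_zero,
    add_zero, zero_add, annihilation_conjTranspose_mul, annihilation_mul_conjTranspose]
  rw [Matrix.fromBlocks_diagonal, Matrix.l2_opNorm_diagonal,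
    pi_norm_le_iff_of_nonneg (by positivity)]
  rintro (n | n)
  · simp only [Sum.elim_inl, Complex.norm_natCast, Nat.cast_le]
    omega
  · simp only [Sum.elim_inr]
    split_ifs with h
    · have : ((n : ℕ) : ℂ) + 1 = ((n + 1 : ℕ) : ℂ) := by push_cast; rfl
      rw [this, Complex.norm_natCast, Nat.cast_le]
      omega
    · simp

lemma fromBlocks_diagonal_pow (Λ : ℕ) (a b : Matrix (Fin (Λ + 1)) (Fin (Λ + 1)) ℂ) (k : ℕ) :
    (Matrix.fromBlocks a 0 0 b : Op Λ) ^ k = Matrix.fromBlocks (a ^ k) 0 0 (b ^ k) := by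
  induction k with
  | zero => simp
  | succ k ih => simp [pow_succ, ih, Matrix.fromBlocks_multiply]

/-- Multiplying by X turns the off-diagonal block matrix into the k-th power of diag(a, a†). -/
lemma norm_hamSA_le (Λ k : ℕ) : ‖hamSA Λ k‖ ≤ Real.sqrt Λ ^ k := by
  change ‖blockHam Λ k‖ ≤ _
  have h : blockHam Λ k = Gate.mat Λ Gate.x *
      (Matrix.fromBlocks (annihilation Λ) 0 0 (annihilation Λ)ᴴ : Op Λ) ^ k := by
    rw [fromBlocks_diagonal_pow]
    simp [Gate.mat, qubitOp, Matrix.fromBlocks_multiply, blockHam, creation]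
  rw [h]
  have h2 : ‖Gate.mat Λ Gate.x‖ = 1 := CStarRing.norm_coe_unitary (gateU Λ Gate.x)
  refine (norm_mul_le _ _).trans ?_
  rw [h2, one_mul]
  refine (norm_pow_le _ _).trans ?_
  gcongr
  exact norm_blockDiagonal_annihilation_le Λ

/-! ### The block encodings -/

/-- Write A = a^k, B = (a†)^k, and X, Y, Z for the Pauli matrices. The first commutator is Z ⊗ (A² -
B²), and conjugation by SH sends Z to Y. The second is -iZ ⊗ (A² + B²), and H sends Z to X. With the
factors i and 1/2 the sum has upper right block A² and lower left block B²; the outer X swaps them.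
-/
lemma hamSA_two_mul (Λ k : ℕ) :
    conjSA (circU Λ [Gate.x])
      ((1 / 2 : ℝ) • conjSA (circU Λ [Gate.s, Gate.h])
          (commutatorSA (conjSA (circU Λ [Gate.x]) (hamSA Λ k)) (hamSA Λ k))
        + (1 / 2 : ℝ) • conjSA (circU Λ [Gate.h])
          (commutatorSA (conjSA (circU Λ [Gate.s]) (hamSA Λ k))
            (conjSA (circU Λ [Gate.x]) (hamSA Λ k))))
      = hamSA Λ (2 * k) := by
  have hX : conjSA (circU Λ [Gate.x]) (hamSA Λ k)
      = (Matrix.fromBlocks 0 (annihilation Λ ^ k) (creation Λ ^ k) 0 : Op Λ) := by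
    simp only [conjSA, circU, hamSA, blockHam, gateU, Gate.mat, List.map_cons, List.map_nil,
      List.prod_cons, List.prod_nil, mul_one, star_qubitOp]
    simp [qubitOp, Matrix.fromBlocks_multiply]
  have hS : conjSA (circU Λ [Gate.s]) (hamSA Λ k)
      = (Matrix.fromBlocks 0 (-Complex.I • creation Λ ^ k) (Complex.I • annihilation Λ ^ k) 0
        : Op Λ) := by
    simp only [conjSA, circU, hamSA, blockHam, gateU, Gate.mat, List.map_cons, List.map_nil,
      List.prod_cons, List.prod_nil, mul_one, star_qubitOp]
    simp [qubitOp, Matrix.fromBlocks_multiply]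
  have hM : (hamSA Λ k : Op Λ)
      = Matrix.fromBlocks 0 (creation Λ ^ k) (annihilation Λ ^ k) 0 := rfl
  have hI := Complex.I_mul_I
  ext1
  change _ = (Matrix.fromBlocks 0 (creation Λ ^ (2 * k)) (annihilation Λ ^ (2 * k)) 0 : Op Λ)
  simp only [conjSA, selfAdjoint.val_smul, AddSubgroup.coe_add, commutatorSA] at hX hS ⊢
  rw [hX, hS, hM]
  rw [mul_comm 2 k, pow_mul, pow_mul]
  generalize annihilation Λ ^ k = a
  generalize creation Λ ^ k = b
  simp only [circU, gateU, Gate.mat, List.map_cons, List.map_nil,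
      List.prod_cons, List.prod_nil, mul_one, star_qubitOp, Submonoid.coe_mul, qubitOp_mul]
  have hr := sqrt_two_inv_mul_self
  rw [Complex.ofReal_inv] at hr
  -- The same scalar occurs in three nestings: 1/2 from the prefactor, 1/2 from the two Hadamard
  -- factors, and -1 from i².
  have e1 : ∀ x : Matrix (Fin (Λ + 1)) (Fin (Λ + 1)) ℂ, (2⁻¹ : ℝ) • ((Real.sqrt 2 : ℝ) : ℂ)⁻¹ •
      Complex.I • (Complex.I * ((Real.sqrt 2 : ℝ) : ℂ)⁻¹) • x = (-1 / 4 : ℂ) • x := fun x => by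
    rw [← Complex.coe_smul, smul_smul, smul_smul, smul_smul]
    congr 1
    push_cast
    linear_combination (1 / 2) * (Complex.I * Complex.I) * hr + (1 / 4) * hI
  have e2 : ∀ x : Matrix (Fin (Λ + 1)) (Fin (Λ + 1)) ℂ, (2⁻¹ : ℝ) • ((Real.sqrt 2 : ℝ) : ℂ)⁻¹ •
      Complex.I • ((Real.sqrt 2 : ℝ) : ℂ)⁻¹ • Complex.I • x = (-1 / 4 : ℂ) • x := fun x => by
    rw [← Complex.coe_smul, smul_smul, smul_smul, smul_smul, smul_smul]
    congr 1
    push_cast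
    linear_combination (1 / 2) * (Complex.I * Complex.I) * hr + (1 / 4) * hI
  have e3 : ∀ x : Matrix (Fin (Λ + 1)) (Fin (Λ + 1)) ℂ, (2⁻¹ : ℝ) •
      (Complex.I * ((Real.sqrt 2 : ℝ) : ℂ)⁻¹) • Complex.I • ((Real.sqrt 2 : ℝ) : ℂ)⁻¹ • x
      = (-1 / 4 : ℂ) • x := fun x => by
    rw [← Complex.coe_smul, smul_smul, smul_smul, smul_smul]
    congr 1
    push_cast
    linear_combination (1 / 2) * (Complex.I * Complex.I) * hr + (1 / 4) * hI
  simp only [qubitOp, Matrix.fromBlocks_multiply, Matrix.fromBlocks_smul, Matrix.fromBlocks_add,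
    sub_eq_add_neg, Matrix.fromBlocks_neg, smul_zero, zero_mul, mul_zero, add_zero, zero_add,
    neg_zero, zero_smul, one_smul, mul_one, one_mul, smul_mul_assoc, mul_smul_comm]
  rw [Matrix.fromBlocks_inj]
  refine ⟨?_, ?_, ?_, ?_⟩
  · simp
  · simp [e1, e2, pow_two]
    module
  · simp [e2, e3, pow_two]
    module
  · simp

/-- The scale `Λ ^ (k / 2)`, an upper bound for the norm of `a ^ k`. -/
def scale (k Λ : ℕ) : ℝ := Real.sqrt Λ ^ k

lemma scale_pos (k Λ : ℕ) (h : 1 ≤ Λ) : 0 < scale k Λ := by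
  unfold scale
  have : (0 : ℝ) < Λ := by exact_mod_cast h
  positivity

lemma norm_half_smul_conjSA_commutatorSA_le {Λ : ℕ} {M N : selfAdjoint (Op Λ)} {ν : ℝ}
    (g : unitary (Op Λ)) (hM : ‖M‖ ≤ ν) (hN : ‖N‖ ≤ ν) :
    ‖(1 / 2 : ℝ) • conjSA g (commutatorSA M N)‖ ≤ ν ^ 2 := by
  have := norm_commutatorSA_le hM hN
  rw [norm_smul, norm_conjSA, Real.norm_of_nonneg (by norm_num)]
  linarith

lemma Approx.addWith {U : ℝ → Circuit} {k : ℕ} {p : ℝ}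
    (hU : Approx U (hamSA · k) (scale k) (2 * p))
    (hp : 0 ≤ p) {q s : ℕ} (hq : 1 ≤ q) (hs : 1 ≤ s) (hqp : 2 * p ≤ 2 * (q : ℝ) + 1)
    (hsp : p ≤ 2 * (s : ℝ) + 1) :
    Approx (addWith q s U U) (hamSA · (2 * k)) (scale (2 * k)) p := by
  obtain ⟨q, rfl⟩ := Nat.exists_eq_add_of_le' hq
  obtain ⟨s, rfl⟩ := Nat.exists_eq_add_of_le' hs
  push_cast at hqp hsp
  have hX := hU.conj [Gate.x]
  have hS := hU.conj [Gate.s]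
  have hM : ∀ Λ, ‖hamSA Λ k‖ ≤ scale k Λ := fun Λ => norm_hamSA_le Λ k
  have hM' : ∀ c Λ, ‖conjSA (circU Λ c) (hamSA Λ k)‖ ≤ scale k Λ := fun c Λ => by
    rw [norm_conjSA]; exact hM Λ
  have hL := hX.bch hU (scale_pos k) (hM' _) hM hp (by linarith : 2 * p ≤ 2 * (q : ℝ) + 3)
    [Gate.s, Gate.h]
  have hR := hS.bch hX (scale_pos k) (hM' _) (hM' _) hp (by linarith : 2 * p ≤ 2 * (q : ℝ) + 3)
    [Gate.h]
  have hT := (hL.trotter hR (fun Λ h => by have := scale_pos k Λ h; positivity)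
    (fun Λ => norm_half_smul_conjSA_commutatorSA_le _ (hM' _ Λ) (hM Λ))
    (fun Λ => norm_half_smul_conjSA_commutatorSA_le _ (hM' _ Λ) (hM' _ Λ)) hp
    (by linarith : p ≤ 2 * (s : ℝ) + 3)).conj [Gate.x]
  have e1 : scale (2 * k) = fun Λ => scale k Λ ^ 2 := by
    funext Λ
    rw [scale, scale, ← pow_mul, mul_comm]
  simp only [hamSA_two_mul] at hT
  rw [e1]
  exact hT

/-- The gate is exact, so the error constant is 0 and every order p is available to start the
induction. -/
lemma approx_s1Family (p : ℝ) : Approx s1Family (hamSA · 1) (scale 1) p where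
  neg Λ t := by
    simp only [s1Family, circU, List.map_cons, List.map_nil, List.prod_cons, List.prod_nil, mul_one]
    exact gateU_inv Λ (Gate.s1 t)
  zero Λ := by
    refine Eq.trans (Subtype.ext ?_) (expFamily_zero (hamSA Λ 1))
    rw [coe_expFamily_hamSA, coe_circU]
    simp [Circuit.eval, s1Family, Gate.mat]
  bound := by
    refine ⟨0, le_rfl, fun Λ _ t => ?_⟩
    rw [coe_expFamily_hamSA, coe_circU]
    simp [Circuit.eval, s1Family, Gate.mat]

lemma le_adderOrder (p : ℝ) : p ≤ 2 * (adderOrder p : ℝ) + 1 := by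
  have h1 : (⌈(p - 1) / 2⌉₊ : ℝ) ≤ adderOrder p := by exact_mod_cast le_max_left _ _
  have := Nat.le_ceil ((p - 1) / 2)
  linarith

lemma one_le_adderOrder (p : ℝ) : 1 ≤ adderOrder p := le_max_right _ _

lemma Approx.add {U : ℝ → Circuit} {k : ℕ} {p : ℝ}
    (hU : Approx U (hamSA · k) (scale k) (2 * p))
    (hp : 0 ≤ p) : Approx (add (2 * p) (2 * p) U U) (hamSA · (2 * k)) (scale (2 * k)) p := by
  have h := le_adderOrder (2 * p)
  unfold QubitBoson.add
  rw [min_self]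
  exact hU.addWith hp (one_le_adderOrder _) (one_le_adderOrder _) h (by linarith)

lemma approx_powerAllAdd (ℓ : ℕ) {p : ℝ} (hp : 0 ≤ p) :
    Approx (powerAllAdd ℓ p) (hamSA · (2 ^ ℓ)) (scale (2 ^ ℓ)) p := by
  induction ℓ generalizing p with
  | zero => exact approx_s1Family p
  | succ ℓ ih =>
    rw [pow_succ']
    exact (ih (by positivity)).add hp

lemma approx_power (ℓ : ℕ) {p : ℝ} (hp : 0 < p) :
    Approx (power ℓ p) (hamSA · (2 ^ ℓ)) (scale (2 ^ ℓ)) p := by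
  induction ℓ generalizing p with
  | zero => exact approx_s1Family p
  | succ ℓ ih =>
    rw [pow_succ']
    cases ℓ with
    | zero =>
      -- Since the inputs are exact, only p ≤ 2⌈p/2⌉ + 1 is required of the Trotter order; p > 0
      -- keeps that order at least 1, as order 0 is the empty circuit.
      have h : p / 2 ≤ (⌈p / 2⌉₊ : ℝ) := Nat.le_ceil _
      exact (approx_s1Family (2 * p)).addWith hp.le (one_le_adderOrder _)
        (Nat.one_le_ceil_iff.mpr (by positivity)) (le_adderOrder _) (by linarith)
    | succ ℓ => exact (ih (by positivity)).add hp.le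

/-! ### Gate counts -/

lemma s1Count_append (c d : Circuit) :
    Circuit.s1Count (c ++ d) = c.s1Count + d.s1Count := List.countP_append

lemma s1Count_inv (c : Circuit) : c.inv.s1Count = c.s1Count := by
  rw [Circuit.s1Count, Circuit.inv, List.countP_reverse, List.countP_map]
  congr 1
  funext g
  cases g <;> rfl

section Counts

variable {U V : ℝ → Circuit} {n : ℕ}

/-- The formulas evaluate their inputs at many different times, so the induction carries a count
that does not depend on time. -/
lemma s1Count_bch (hU : ∀ t, (U t).s1Count = n) (hV : ∀ t, (V t).s1Count = n) (q : ℕ) (t : ℝ) :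
    (bch (q + 1) U V t).s1Count = 4 * 6 ^ q * n := by
  induction q generalizing t with
  | zero => simp only [bch, s1Count_append, hU, hV]; ring
  | succ q ih => simp only [bch, s1Count_append, s1Count_inv, ih]; ring

lemma s1Count_trotter (hU : ∀ t, (U t).s1Count = n) (hV : ∀ t, (V t).s1Count = n) (s : ℕ)
    (t : ℝ) : (trotter (s + 1) U V t).s1Count = 4 * 5 ^ s * n := by
  induction s generalizing t with
  | zero => simp only [trotter, s1Count_append, hU, hV]; ring
  | succ s ih => simp only [trotter, s1Count_append, ih]; ring

lemma s1Count_oddExtend (hU : ∀ t, (U t).s1Count = n) (t : ℝ) :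
    (oddExtend U t).s1Count = n := by
  unfold oddExtend
  split_ifs
  · exact hU t
  · rw [s1Count_inv, hU]

lemma s1Count_conj {c d : Circuit} (hc : c.s1Count = 0) (hd : d.s1Count = 0)
    (hU : ∀ t, (U t).s1Count = n) (t : ℝ) : Circuit.s1Count (c ++ U t ++ d) = n := by
  rw [s1Count_append, s1Count_append, hc, hd, hU, zero_add, add_zero]

lemma s1Count_addWith (hU : ∀ t, (U t).s1Count = n) (q s : ℕ) (t : ℝ) :
    (addWith (q + 1) (s + 1) U U t).s1Count = 16 * (5 ^ s * 6 ^ q) * n := by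
  have hX : ∀ t, (conjX U t).s1Count = n := s1Count_conj rfl rfl hU
  have hS : ∀ t, (conjS U t).s1Count = n := s1Count_conj rfl rfl hU
  have hL : ∀ t, (addLeft (q + 1) U U t).s1Count = 4 * 6 ^ q * n :=
    s1Count_oddExtend fun t => s1Count_conj rfl rfl
      (U := fun t => bch (q + 1) (conjX U) U (Real.sqrt (t / 2)))
      (fun t => s1Count_bch hX hU q _) t
  have hR : ∀ t, (addRight (q + 1) U U t).s1Count = 4 * 6 ^ q * n :=
    s1Count_oddExtend fun t => s1Count_conj rfl rfl
      (U := fun t => bch (q + 1) (conjS U) (conjX U) (Real.sqrt (t / 2)))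
      (fun t => s1Count_bch hS hX q _) t
  have := s1Count_conj (c := [Gate.x]) (d := [Gate.x]) rfl rfl (s1Count_trotter hL hR s) t
  refine Eq.trans this ?_
  ring

end Counts

lemma exists_adderOrder_eq {p : ℝ} (hp : 1 ≤ p) :
    ∃ q : ℕ, adderOrder (2 * p) = q + 1 ∧ (q : ℝ) ≤ p - 1 / 2 := by
  obtain ⟨q, hq⟩ := Nat.exists_eq_add_of_le' (one_le_adderOrder (2 * p))
  refine ⟨q, hq, ?_⟩
  have h1 : (⌈(2 * p - 1) / 2⌉₊ : ℝ) < (2 * p - 1) / 2 + 1 := Nat.ceil_lt_add_one (by linarith)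
  have h2 : (adderOrder (2 * p) : ℝ) ≤ p + 1 / 2 := by
    rw [adderOrder, Nat.cast_max]
    exact max_le (by linarith) (by push_cast; linarith)
  rw [hq] at h2
  push_cast at h2
  linarith

/-- Turns the spare 1/2 in the exponent into a factor 1/√b ≤ 1/x. -/
lemma pow_le_rpow_div {b x y p : ℝ} {q : ℕ} (hb : 1 ≤ b) (hq : (q : ℝ) ≤ p - 1 / 2) (hx : 0 < x)
    (hxb : x ^ 2 ≤ b) (hy : b ^ p = y) : b ^ q ≤ y / x := by
  have hb0 : 0 < b := by linarith
  rw [le_div_iff₀ hx, ← Real.rpow_natCast, ← hy]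
  calc b ^ (q : ℝ) * x ≤ b ^ (p - 1 / 2) * b ^ (1 / 2 : ℝ) := by
        gcongr
        rw [← Real.sqrt_eq_rpow]
        exact Real.le_sqrt_of_sq_le hxb
    _ = b ^ p := by rw [← Real.rpow_add hb0]; congr 1; ring

/-- Every step of ADD multiplies the gate count by at most `6 * 30 ^ p`. -/
lemma s1Count_add_le {U : ℝ → Circuit} {n : ℕ} {p : ℝ} (hp : 1 ≤ p)
    (hU : ∀ t, (U t).s1Count = n) :
    ∃ m : ℕ, (∀ t, (add (2 * p) (2 * p) U U t).s1Count = m) ∧ (m : ℝ) ≤ 6 * 30 ^ p * n := by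
  obtain ⟨q, hq, hqp⟩ := exists_adderOrder_eq hp
  refine ⟨16 * (5 ^ q * 6 ^ q) * n, fun t => ?_, ?_⟩
  · rw [add, min_self, hq, s1Count_addWith hU]
  · have h := pow_le_rpow_div (b := 30) (x := 5) (by norm_num) hqp (by norm_num) (by norm_num) rfl
    have h0 : (0 : ℝ) < 30 ^ p := by positivity
    have e : ((5 : ℝ) ^ q * 6 ^ q) = 30 ^ q := by rw [← mul_pow]; norm_num
    push_cast
    rw [e]
    calc (16 : ℝ) * 30 ^ q * n ≤ 16 * (30 ^ p / 5) * n := by gcongr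
      _ ≤ 6 * 30 ^ p * n :=
        mul_le_mul_of_nonneg_right (by linarith) (Nat.cast_nonneg n)

lemma s1Count_powerAllAdd (ℓ : ℕ) {p : ℝ} (hp : 1 ≤ p) :
    ∃ n : ℕ, (∀ t, (powerAllAdd ℓ p t).s1Count = n) ∧
      (n : ℝ) ≤ 6 ^ ℓ * 30 ^ (((2 : ℝ) ^ ℓ - 1) * p) := by
  induction ℓ generalizing p with
  | zero => exact ⟨1, fun t => rfl, by simp⟩
  | succ ℓ ih =>
    obtain ⟨n, hn, hb⟩ := ih (p := 2 * p) (by linarith)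
    obtain ⟨m, hm, hmb⟩ := s1Count_add_le hp hn
    refine ⟨m, hm, hmb.trans ?_⟩
    calc 6 * (30 : ℝ) ^ p * n ≤ 6 * 30 ^ p * (6 ^ ℓ * 30 ^ (((2 : ℝ) ^ ℓ - 1) * (2 * p))) := by
          gcongr
      _ = 6 ^ (ℓ + 1) * (30 ^ p * 30 ^ (((2 : ℝ) ^ ℓ - 1) * (2 * p))) := by ring
      _ = _ := by
        rw [← Real.rpow_add (by norm_num)]
        congr 2
        ring

lemma s1Count_secondOrder {p : ℝ} (hp : 1 ≤ p) :
    ∃ n : ℕ, (∀ t, (secondOrder p t).s1Count = n) ∧ (n : ℝ) ≤ 12 * 14 ^ p := by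
  obtain ⟨q, hq, hqp⟩ := exists_adderOrder_eq hp
  obtain ⟨s, hs⟩ := Nat.exists_eq_add_of_le' (Nat.one_le_ceil_iff.mpr (by linarith : 0 < p / 2))
  have hsp : (s : ℝ) ≤ p / 2 := by
    have := Nat.ceil_lt_add_one (by linarith : 0 ≤ p / 2)
    rw [hs] at this
    push_cast at this
    linarith
  refine ⟨16 * (5 ^ s * 6 ^ q) * 1, fun t => ?_, ?_⟩
  · rw [secondOrder, hq, hs]
    exact s1Count_addWith (U := s1Family) (n := 1) (fun _ => rfl) q s t
  · have h6 := pow_le_rpow_div (b := 6) (x := 2) (by norm_num) hqp (by norm_num) (by norm_num) rfl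
    -- 7/3 is a rational upper bound for √5 chosen so that (7/3)·6 = 14.
    have h5 : (5 : ℝ) ^ s ≤ (7 / 3) ^ p := by
      calc (5 : ℝ) ^ s = 5 ^ (s : ℝ) := (Real.rpow_natCast _ _).symm
        _ ≤ 5 ^ (p / 2) := Real.rpow_le_rpow_of_exponent_le (by norm_num) hsp
        _ ≤ ((7 / 3) ^ 2) ^ (p / 2) := Real.rpow_le_rpow (by norm_num) (by norm_num) (by linarith)
        _ = _ := by
          rw [← Real.rpow_natCast, ← Real.rpow_mul (by norm_num)]
          congr 1
          push_cast
          ring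
    push_cast
    calc (16 : ℝ) * (5 ^ s * 6 ^ q) * 1 ≤ 16 * ((7 / 3) ^ p * (6 ^ p / 2)) * 1 := by gcongr
      _ = 8 * ((7 / 3) ^ p * 6 ^ p) := by ring
      _ = 8 * 14 ^ p := by rw [← Real.mul_rpow (by norm_num) (by norm_num)]; norm_num
      _ ≤ _ := by gcongr; norm_num

/-- The extra factor 30^p makes the recursion close: a step from order 2p costs 6·30^p, and
30^p·30^p is exactly the factor attached to 2p. At the base, 14·30 = 420. -/
lemma s1Count_power (ℓ : ℕ) {p : ℝ} (hp : 1 ≤ p) :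
    ∃ n : ℕ, (∀ t, (power (ℓ + 1) p t).s1Count = n) ∧
      (n : ℝ) * 30 ^ p ≤ 2 * 6 ^ (ℓ + 1) * 420 ^ ((2 : ℝ) ^ ℓ * p) := by
  induction ℓ generalizing p with
  | zero =>
    obtain ⟨n, hn, hb⟩ := s1Count_secondOrder hp
    refine ⟨n, hn, ?_⟩
    calc (n : ℝ) * 30 ^ p ≤ 12 * 14 ^ p * 30 ^ p := by gcongr
      _ = 12 * 420 ^ p := by
        rw [mul_assoc, ← Real.mul_rpow (by norm_num) (by norm_num)]; norm_num
      _ = _ := by norm_num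
  | succ ℓ ih =>
    obtain ⟨n, hn, hb⟩ := ih (p := 2 * p) (by linarith)
    obtain ⟨m, hm, hmb⟩ := s1Count_add_le hp hn
    refine ⟨m, hm, ?_⟩
    calc (m : ℝ) * 30 ^ p ≤ 6 * 30 ^ p * n * 30 ^ p := by gcongr
      _ = 6 * (n * (30 ^ p * 30 ^ p)) := by ring
      _ = 6 * (n * 30 ^ (2 * p)) := by rw [← Real.rpow_add (by norm_num), two_mul]
      _ ≤ 6 * (2 * 6 ^ (ℓ + 1) * 420 ^ ((2 : ℝ) ^ ℓ * (2 * p))) := by gcongr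
      _ = 2 * 6 ^ (ℓ + 1 + 1) * 420 ^ ((2 : ℝ) ^ ℓ * (2 * p)) := by ring
      _ = _ := by rw [show (2 : ℝ) ^ ℓ * (2 * p) = 2 ^ (ℓ + 1) * p by ring]

/-! ### The main theorem -/

lemma scale_eq_rpow (k Λ : ℕ) : scale k Λ = (Λ : ℝ) ^ ((k : ℝ) / 2) := by
  rw [scale, Real.sqrt_eq_rpow, ← Real.rpow_mul_natCast (by positivity)]
  congr 1
  ring

lemma Approx.exists_bound {U : ℝ → Circuit} {k : ℕ} {p : ℝ}
    (hU : Approx U (hamSA · k) (scale k) p) :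
    ∃ C : ℝ, 0 ≤ C ∧ ∀ Λ : ℕ, 1 ≤ Λ → ∀ t : ℝ, 0 ≤ t →
      (U t).eval Λ ∈ Matrix.unitaryGroup (Idx Λ) ℂ ∧
        ‖(U t).eval Λ - target Λ k t‖ ≤ C * ((Λ : ℝ) ^ ((k : ℝ) / 2) * t) ^ p := by
  obtain ⟨C, hC, hb⟩ := hU.bound
  refine ⟨C, hC, fun Λ hΛ t ht => ⟨?_, ?_⟩⟩
  · rw [← coe_circU]
    exact (circU Λ (U t)).2
  · have := hb Λ hΛ t
    rwa [coe_circU, coe_expFamily_hamSA, scale_eq_rpow, abs_of_nonneg ht] at this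

end

end QubitBoson


theorem mainTheorem2 (ℓ k : ℕ) (hℓ : 1 ≤ ℓ) (hk : k = 2 ^ ℓ) (p : ℝ) (hp : 1 ≤ p) :
    (∃ C : ℝ, 0 < C ∧ ∀ Λ : ℕ, 1 ≤ Λ → ∀ t : ℝ, 0 ≤ t →
      ((QubitBoson.power ℓ p t).eval Λ ∈ Matrix.unitaryGroup (QubitBoson.Idx Λ) ℂ ∧
        ‖(QubitBoson.power ℓ p t).eval Λ - QubitBoson.target Λ k t‖
          ≤ C * ((Λ : ℝ) ^ ((k : ℝ) / 2) * t) ^ p) ∧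
      ((QubitBoson.powerAllAdd ℓ p t).eval Λ ∈ Matrix.unitaryGroup (QubitBoson.Idx Λ) ℂ ∧
        ‖(QubitBoson.powerAllAdd ℓ p t).eval Λ - QubitBoson.target Λ k t‖
          ≤ C * ((Λ : ℝ) ^ ((k : ℝ) / 2) * t) ^ p)) ∧
    (∀ t : ℝ, 0 ≤ t →
      ((QubitBoson.power ℓ p t).s1Count : ℝ)
        ≤ (6 : ℝ) ^ Real.logb 2 (k : ℝ) * (420 : ℝ) ^ ((k : ℝ) * p / 2) ∧
      ((QubitBoson.powerAllAdd ℓ p t).s1Count : ℝ)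
        ≤ (6 : ℝ) ^ Real.logb 2 (k : ℝ) * (30 : ℝ) ^ (((k : ℝ) - 1) * p)) := by
  subst hk
  constructor
  · obtain ⟨C₁, hC₁, h₁⟩ := (QubitBoson.approx_power ℓ (by linarith : 0 < p)).exists_bound
    obtain ⟨C₂, hC₂, h₂⟩ := (QubitBoson.approx_powerAllAdd ℓ (by linarith : 0 ≤ p)).exists_bound
    refine ⟨C₁ + C₂ + 1, by positivity, fun Λ hΛ t ht => ?_⟩
    obtain ⟨u₁, b₁⟩ := h₁ Λ hΛ t ht
    obtain ⟨u₂, b₂⟩ := h₂ Λ hΛ t ht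
    refine ⟨⟨u₁, b₁.trans ?_⟩, u₂, b₂.trans ?_⟩ <;> gcongr <;> linarith
  · intro t _
    have hlog : (6 : ℝ) ^ Real.logb 2 ((2 ^ ℓ : ℕ) : ℝ) = 6 ^ ℓ := by
      push_cast
      rw [Real.logb_pow, Real.logb_self_eq_one (by norm_num), mul_one, Real.rpow_natCast]
    rw [hlog]
    push_cast
    obtain ⟨l, rfl⟩ := Nat.exists_eq_add_of_le' hℓ
    obtain ⟨n, hn, hnb⟩ := QubitBoson.s1Count_power l hp
    obtain ⟨m, hm, hmb⟩ := QubitBoson.s1Count_powerAllAdd (l + 1) hp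
    rw [hn, hm]
    refine ⟨?_, hmb⟩
    -- The auxiliary factor 30^p on the left absorbs the 2 on the right of `s1Count_power`.
    have h30 : (2 : ℝ) ≤ 30 ^ p := by
      calc (2 : ℝ) ≤ 30 ^ (1 : ℝ) := by norm_num
        _ ≤ 30 ^ p := Real.rpow_le_rpow_of_exponent_le (by norm_num) hp
    have e : (2 : ℝ) ^ (l + 1) * p / 2 = 2 ^ l * p := by ring
    rw [e]
    have h0 : (0 : ℝ) ≤ n := by positivity
    nlinarith
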